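/- Let $p$ be a prime, $K/\mathbb{Q}_p$ a finite extension, $G_K$ its absolute Galois group, $I_K\subset G_K$ the inertia subgroup and $\mathrm{Frob}_K\in G_K$ a geometric Frobenius element. Let $F/\mathbb{Q}_p$ be a finite extension with ring of integers $\mathcal{O}$ and residue field $\mathbb{F}$, and let $X$ be an $\mathcal{O}[G_K]$-module, free of finite rank over $\mathcal{O}$, on which $G_K$ acts continuously for the $p$-adic topology. Suppose that there is a field $E$ with $\mathbb{Q}_p\subset E\subset F$ such that $X$ is realisable over $\mathcal{O}_E$ (i.e. $X\cong X_0\otimes_{\mathcal{O}_E}\mathcal{O}$ for an $\mathcal{O}_E[G_K]$-module $X_0$ finite free over $\mathcal{O}_E$) and such that the ramification index satisfies $e(F/E)>\mathrm{rank}_{\mathcal{O}}(X)$. Let $v_E$ be the valuation on $F$ taking the value $1$ on a uniformiser of $E$. Let $\psi:G_K\to\mathcal{O}^\times$ be a continuous unramified character (i.e. $\psi|_{I_K}=1$) with $0<v_E(\psi(\mathrm{Frob}_K)-1)<1/\mathrm{rank}_{\mathcal{O}}(X)$ (for $X=0$ the upper bound is only the requirement $\psi(\mathrm{Frob}_K)\neq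 1$). Let $\mathcal{O}(\psi)$ denote $\mathcal{O}$ with $G_K$ acting through $\psi$, put $X_\psi=X\otimes_{\mathcal{O}}\mathcal{O}(\psi)$, and assume that $X_\psi^{G_K}=0$. Then $\psi$ is trivial modulo the maximal ideal of $\mathcal{O}$, so that $X_\psi\otimes_{\mathcal{O}}\mathbb{F}=X\otimes_{\mathcal{O}}\mathbb{F}$ as $G_K$-modules. Let $$\delta^\vee: H^0(G_K, X_\psi\otimes_{\mathcal{O}}F/\mathcal{O})\to H^1(G_K,X\otimes_{\mathcal{O}}\mathbb{F})$$ be the connecting map of $0\to X_\psi\to X_\psi\otimes_{\mathcal{O}} F\to X_\psi\otimes_{\mathcal{O}} F/\mathcal{O}\to 0$ followed by reduction: an invariant element with lift $b\in X_\psi\otimes_{\mathcal{O}} F$ goes to the class of the continuous cocycle sending $g$ to the image of $gb-b\in X_\psi$ in $X\otimes_{\mathcal{O}}\mathbb{F}$. Then the image of $\delta^\vee$ is equal to the subspace of unramified classes $$H^1_{\mathrm{ur}}(G_K,X\otimes_{\mathcal{O}}\mathbb{F})=\ker\bigl(H^1(G_K,X\otimes_{\mathcal{O}}\mathbb{F})\to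 H^1(I_K,X\otimes_{\mathcal{O}}\mathbb{F})\bigr).$$ In particular this image depends only on the $G_K$-module $X\otimes_{\mathcal{O}}\mathbb{F}$, and not on $X$, $F$ or $\psi$: if $F',X',\psi'$ (with a suitable $E'$) satisfy the same hypotheses, then any $G_K$-equivariant isomorphism of abelian groups $X\otimes_{\mathcal{O}}\mathbb{F}\cong X'\otimes_{\mathcal{O}'}\mathbb{F}'$ carries the image of $\delta^\vee$ onto that of the map attached to $F',X',\psi'$. -/

import Mathlib

open scoped TensorProduct

noncomputable section

namespace GalTwist

/-! ### Continuous cohomology in degree one, with discrete coefficients -/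

section Cohomology

variable {R G M : Type*} [CommRing R] [Group G] [TopologicalSpace G] [AddCommGroup M] [Module R M]

/-- Continuous `1`-cocycles of `G` with values in the discrete module `M`
(continuous maps to a discrete space are the locally constant ones). -/
def Z1 (ρ : Representation R G M) : Submodule R (G → M) where
  carrier := {c | IsLocallyConstant c ∧ ∀ g h, c (g * h) = c g + ρ g (c h)}
  zero_mem' := ⟨IsLocallyConstant.const 0, fun g h => by simp⟩
  add_mem' := by
    rintro a b ⟨ha, ha'⟩ ⟨hb, hb'⟩
    refine ⟨ha.add hb, fun g h => ?_⟩
    simp only [Pi.add_apply, ha', hb', map_add]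
    abel
  smul_mem' := by
    rintro r a ⟨ha, ha'⟩
    refine ⟨ha.comp (fun m => r • m), fun g h => ?_⟩
    simp only [Pi.smul_apply, ha', map_smul, smul_add]

/-- The `1`-coboundaries `g ↦ g m - m`, inside the continuous `1`-cocycles. -/
def B1 (ρ : Representation R G M) : Submodule R (Z1 ρ) where
  carrier := {c | ∃ m : M, ∀ g, c.1 g = ρ g m - m}
  zero_mem' := ⟨0, fun g => by simp⟩
  add_mem' := by
    rintro a b ⟨m, hm⟩ ⟨n, hn⟩
    refine ⟨m + n, fun g => ?_⟩
    simp only [Submodule.coe_add, Pi.add_apply, hm, hn, map_add]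
    abel
  smul_mem' := by
    rintro r a ⟨m, hm⟩
    refine ⟨r • m, fun g => ?_⟩
    simp only [Submodule.coe_smul, Pi.smul_apply, hm, map_smul, smul_sub]

/-- `H¹(G, M)`. -/
abbrev H1 (ρ : Representation R G M) : Type _ := Z1 ρ ⧸ B1 ρ

/-- The action of a subgroup. -/
abbrev resRep (ρ : Representation R G M) (I : Subgroup G) : Representation R I M :=
  ρ.comp I.subtype

/-- Restriction of cocycles to a subgroup. -/
def Z1res (ρ : Representation R G M) (I : Subgroup G) : Z1 ρ →ₗ[R] Z1 (resRep ρ I) where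
  toFun c := ⟨fun g => c.1 g, c.2.1.comp_continuous continuous_subtype_val,
    fun g h => c.2.2 g h⟩
  map_add' _ _ := rfl
  map_smul' _ _ := rfl

/-- The restriction map `H¹(G, M) → H¹(I, M)`. -/
def H1res (ρ : Representation R G M) (I : Subgroup G) : H1 ρ →ₗ[R] H1 (resRep ρ I) :=
  Submodule.mapQ (B1 ρ) (B1 (resRep ρ I)) (Z1res ρ I) (by
    rintro c ⟨m, hm⟩
    exact ⟨m, fun g => hm g⟩)

section Functoriality

variable {R' M' : Type*} [CommRing R'] [AddCommGroup M'] [Module R' M']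

/-- The effect on cocycles of a `G`-equivariant additive map. -/
def Z1map (ρ : Representation R G M) (ρ' : Representation R' G M') (f : M →+ M')
    (hf : ∀ g m, f (ρ g m) = ρ' g (f m)) : Z1 ρ →+ Z1 ρ' where
  toFun c := ⟨fun g => f (c.1 g), c.2.1.comp f, fun g h => by
    change f (c.1 (g * h)) = f (c.1 g) + ρ' g (f (c.1 h))
    rw [c.2.2, map_add, hf]⟩
  map_zero' := Subtype.ext (funext fun _ => map_zero f)
  map_add' a b := Subtype.ext (funext fun g => map_add f (a.1 g) (b.1 g))

/-- The map `H¹(G, M) → H¹(G, M')` induced by a `G`-equivariant additive map `M → M'`. -/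
def H1map (ρ : Representation R G M) (ρ' : Representation R' G M') (f : M →+ M')
    (hf : ∀ g m, f (ρ g m) = ρ' g (f m)) : H1 ρ →+ H1 ρ' :=
  QuotientAddGroup.map (B1 ρ).toAddSubgroup (B1 ρ').toAddSubgroup (Z1map ρ ρ' f hf) (by
    rintro c ⟨m, hm⟩
    exact ⟨f m, fun g => by rw [← hf, ← map_sub, ← hm g]; rfl⟩)

end Functoriality

end Cohomology

/-! ### Connecting maps -/

section Connecting

variable {R G : Type*} [CommRing R] [Group G] [TopologicalSpace G]
  {A B C D : Type*} [AddCommGroup A] [Module R A] [AddCommGroup B] [Module R B]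
  [AddCommGroup C] [Module R C] [AddCommGroup D] [Module R D]

/-- A short exact sequence `0 → A → B → C → 0` of `R[G]`-modules (maps `i`, `q`) together with
an `R[G]`-linear map `r : A → D` to a discrete module `D`, such that the
cocycles `g ↦ r (i⁻¹ (g b - b))` arising from lifts `b` of invariants of `C` are continuous. -/
structure ConnectingData (ρA : Representation R G A) (ρB : Representation R G B)
    (ρC : Representation R G C) (ρD : Representation R G D)
    (i : A →ₗ[R] B) (q : B →ₗ[R] C) (r : A →ₗ[R] D) : Prop where
  i_equiv : ∀ g a, i (ρA g a) = ρB g (i a)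
  q_equiv : ∀ g b, q (ρB g b) = ρC g (q b)
  r_equiv : ∀ g a, r (ρA g a) = ρD g (r a)
  inj : Function.Injective i
  exact : Function.Exact i q
  surj : Function.Surjective q
  cont : ∀ (b : B) (c : G → A), (∀ g, i (c g) = ρB g b - b) → IsLocallyConstant fun g => r (c g)

namespace ConnectingData

variable {ρA : Representation R G A} {ρB : Representation R G B}
  {ρC : Representation R G C} {ρD : Representation R G D}
  {i : A →ₗ[R] B} {q : B →ₗ[R] C} {r : A →ₗ[R] D}

/-- The `A`-valued cocycle `g ↦ g b - b` attached to `b ∈ B` with `G`-invariant image in `C`. -/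
theorem exists_cochain (h : ConnectingData ρA ρB ρC ρD i q r) (b : B)
    (hb : q b ∈ ρC.invariants) (g : G) : ∃ a : A, i a = ρB g b - b :=
  (h.exact _).1 (by rw [map_sub, h.q_equiv, hb g, sub_self])

/-- The cocycle `g ↦ r (g b - b)`. -/
def cocycle (h : ConnectingData ρA ρB ρC ρD i q r) (b : B) (hb : q b ∈ ρC.invariants) :
    Z1 ρD :=
  ⟨fun g => r (h.exists_cochain b hb g).choose,
    h.cont b _ fun g => (h.exists_cochain b hb g).choose_spec,
    fun g k => by
      change r (h.exists_cochain b hb (g * k)).choose = r (h.exists_cochain b hb g).choose +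
        ρD g (r (h.exists_cochain b hb k).choose)
      rw [← h.r_equiv, ← map_add]
      congr 1
      apply h.inj
      rw [map_add, h.i_equiv, (h.exists_cochain b hb (g * k)).choose_spec,
        (h.exists_cochain b hb g).choose_spec, (h.exists_cochain b hb k).choose_spec,
        map_mul, map_sub]
      simp⟩

theorem cocycle_eq (h : ConnectingData ρA ρB ρC ρD i q r) (b : B) (hb : q b ∈ ρC.invariants)
    (g : G) (a : A) (ha : i a = ρB g b - b) : (h.cocycle b hb).1 g = r a := by
  change r _ = r a
  congr 1
  exact h.inj ((h.exists_cochain b hb g).choose_spec.trans ha.symm)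

theorem mk_cocycle_eq (h : ConnectingData ρA ρB ρC ρD i q r) (b b' : B)
    (hb : q b ∈ ρC.invariants) (hb' : q b' ∈ ρC.invariants) (e : q b = q b') :
    (Submodule.Quotient.mk (h.cocycle b hb) : H1 ρD) =
      Submodule.Quotient.mk (h.cocycle b' hb') := by
  rw [Submodule.Quotient.eq]
  obtain ⟨a, ha⟩ := (h.exact (b - b')).1 (by rw [map_sub, e, sub_self])
  refine ⟨r a, fun g => ?_⟩
  obtain ⟨u, hu⟩ := h.exists_cochain b hb g
  obtain ⟨v, hv⟩ := h.exists_cochain b' hb' g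
  change (h.cocycle b hb).1 g - (h.cocycle b' hb').1 g = _
  rw [h.cocycle_eq b hb g u hu, h.cocycle_eq b' hb' g v hv, ← h.r_equiv, ← map_sub, ← map_sub]
  congr 1
  apply h.inj
  rw [map_sub, map_sub, h.i_equiv, hu, hv, ha, map_sub]
  abel

/-- A lift to `B` of an element of `C`. -/
def lift (h : ConnectingData ρA ρB ρC ρD i q r) (x : C) : B := Function.surjInv h.surj x

theorem q_lift (h : ConnectingData ρA ρB ρC ρD i q r) (x : C) : q (h.lift x) = x :=
  Function.surjInv_eq h.surj x

theorem q_lift_mem (h : ConnectingData ρA ρB ρC ρD i q r) (x : ρC.invariants) :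
    q (h.lift x.1) ∈ ρC.invariants := by
  rw [h.q_lift]
  exact x.2

/-- The composite `H⁰(G, C) → H¹(G, A) → H¹(G, D)` of the connecting map with the map induced
by `r`: an invariant element of `C` with lift `b ∈ B` goes to the class of `g ↦ r (g b - b)`. -/
def delta (h : ConnectingData ρA ρB ρC ρD i q r) : ρC.invariants →ₗ[R] H1 ρD where
  toFun x := Submodule.Quotient.mk (h.cocycle (h.lift x.1) (h.q_lift_mem x))
  map_add' x y := by
    have e : q (h.lift x.1 + h.lift y.1) = (x + y).1 := by
      rw [map_add, h.q_lift, h.q_lift]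
      rfl
    have e' : q (h.lift x.1 + h.lift y.1) ∈ ρC.invariants := by
      rw [e]
      exact (x + y).2
    rw [← Submodule.Quotient.mk_add,
      h.mk_cocycle_eq _ (h.lift x.1 + h.lift y.1) (h.q_lift_mem (x + y)) e' (by rw [e, h.q_lift])]
    congr 1
    apply Subtype.ext
    funext g
    obtain ⟨u, hu⟩ := h.exists_cochain (h.lift x.1) (h.q_lift_mem x) g
    obtain ⟨v, hv⟩ := h.exists_cochain (h.lift y.1) (h.q_lift_mem y) g
    rw [Submodule.coe_add, Pi.add_apply, h.cocycle_eq _ _ g u hu, h.cocycle_eq _ _ g v hv,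
      h.cocycle_eq _ e' g (u + v) (by rw [map_add, hu, hv, map_add]; abel), map_add]
  map_smul' s x := by
    have e : q (s • h.lift x.1) = (s • x).1 := by
      rw [map_smul, h.q_lift]
      rfl
    have e' : q (s • h.lift x.1) ∈ ρC.invariants := by
      rw [e]
      exact (s • x).2
    rw [RingHom.id_apply, ← Submodule.Quotient.mk_smul,
      h.mk_cocycle_eq _ (s • h.lift x.1) (h.q_lift_mem (s • x)) e' (by rw [e, h.q_lift])]
    congr 1
    apply Subtype.ext
    funext g
    obtain ⟨u, hu⟩ := h.exists_cochain (h.lift x.1) (h.q_lift_mem x) g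
    rw [Submodule.coe_smul, Pi.smul_apply, h.cocycle_eq _ _ g u hu,
      h.cocycle_eq _ e' g (s • u) (by rw [map_smul, hu, map_smul, smul_sub]), map_smul]

theorem delta_eq (h : ConnectingData ρA ρB ρC ρD i q r) (x : ρC.invariants) (b : B)
    (hb : q b = x.1) :
    h.delta x = Submodule.Quotient.mk (h.cocycle b (by rw [hb]; exact x.2)) :=
  h.mk_cocycle_eq _ _ _ _ (by rw [h.q_lift, hb])

end ConnectingData

end Connecting

/-! ### Algebraic extensions of `ℚ_p` -/

section Fields

variable (p : ℕ) [Fact p.Prime]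

/-- The ring of integers of an algebraic extension `L` of `ℚ_p`: the elements of absolute value
at most `1`, for the unique extension to `L` of the `p`-adic absolute value. -/
def integers (L : Type*) [Field L] [Algebra ℚ_[p] L] [Algebra.IsAlgebraic ℚ_[p] L] :
    ValuationSubring L where
  carrier := {x | spectralNorm ℚ_[p] L x ≤ 1}
  mul_mem' {a b} ha hb := by
    have := map_mul (spectralMulAlgNorm ℚ_[p] L) a b
    simp only [spectralMulAlgNorm_def] at this
    change spectralNorm ℚ_[p] L (a * b) ≤ 1
    rw [this]
    exact mul_le_one₀ ha (spectralNorm_nonneg _) hb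
  one_mem' := spectralNorm_one.le
  add_mem' {a b} ha hb := (isNonarchimedean_spectralNorm a b).trans (max_le ha hb)
  zero_mem' := by
    change spectralNorm ℚ_[p] L 0 ≤ 1
    rw [spectralNorm_zero]
    exact zero_le_one
  neg_mem' {a} ha := by
    change spectralNorm ℚ_[p] L (-a) ≤ 1
    rw [spectralNorm_neg (Algebra.IsAlgebraic.isAlgebraic a)]
    exact ha
  mem_or_inv_mem' x := by
    have := map_inv₀ (spectralMulAlgNorm ℚ_[p] L) x
    simp only [spectralMulAlgNorm_def] at this
    change _ ≤ (1 : ℝ) ∨ spectralNorm ℚ_[p] L x⁻¹ ≤ 1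
    rw [this]
    exact (le_total _ 1).imp id fun h => inv_le_one_of_one_le₀ h

/-- The residue field of `L`. -/
abbrev resField (L : Type*) [Field L] [Algebra ℚ_[p] L] [Algebra.IsAlgebraic ℚ_[p] L] : Type _ :=
  IsLocalRing.ResidueField (integers p L)

/-- The ring of integers of `F` is an algebra over that of a subfield `E`. -/
instance integersAlgebra {F : Type*} [Field F] [Algebra ℚ_[p] F] [Algebra.IsAlgebraic ℚ_[p] F]
    (E : IntermediateField ℚ_[p] F) : Algebra (integers p E) (integers p F) :=
  (((algebraMap E F).comp (integers p E).subtype).codRestrict (integers p F) fun x => by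
    have h : spectralNorm ℚ_[p] E x.1 ≤ 1 := x.2
    rw [spectralNorm.eq_of_tower (K := ℚ_[p]) (E := E) (L := F)] at h
    exact h).toAlgebra

/-- The additive valuation on `F` with `v(ϖ) = 1`, for `ϖ` of absolute value in `(0, 1)`.
(The value at `0`, which is `∞` in the usual convention, is not used.) -/
def normalizedVal {F : Type*} [Field F] [Algebra ℚ_[p] F] (ϖ x : F) : ℝ :=
  Real.log (spectralNorm ℚ_[p] F x) / Real.log (spectralNorm ℚ_[p] F ϖ)

/-- The absolute Galois group, with its Krull topology. -/
abbrev absGal (K : Type*) [Field K] : Type _ := AlgebraicClosure K ≃ₐ[K] AlgebraicClosure K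

theorem spectralNorm_absGal (K : Type*) [Field K] [Algebra ℚ_[p] K] (σ : absGal K)
    (x : AlgebraicClosure K) :
    spectralNorm ℚ_[p] (AlgebraicClosure K) (σ x) = spectralNorm ℚ_[p] (AlgebraicClosure K) x :=
  (spectralNorm_eq_of_equiv (σ.restrictScalars ℚ_[p]) x).symm

variable (K : Type*) [Field K] [Algebra ℚ_[p] K] [Algebra.IsAlgebraic ℚ_[p] K]

theorem isAlgebraic_algebraicClosure : Algebra.IsAlgebraic ℚ_[p] (AlgebraicClosure K) :=
  Algebra.IsAlgebraic.trans ℚ_[p] K (AlgebraicClosure K)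

/-- The inertia subgroup `I_K`: the automorphisms inducing the identity on the residue field
of the algebraic closure of `K`. -/
def inertia : Subgroup (absGal K) where
  carrier := {σ | ∀ x : AlgebraicClosure K, spectralNorm ℚ_[p] (AlgebraicClosure K) x ≤ 1 →
    spectralNorm ℚ_[p] (AlgebraicClosure K) (σ x - x) < 1}
  one_mem' x _ := by simp [spectralNorm_zero]
  mul_mem' {σ τ} hσ hτ x hx := by
    have := isAlgebraic_algebraicClosure p K
    have h1 := hσ (τ x) (by rw [spectralNorm_absGal]; exact hx)
    have h2 := hτ x hx
    have h3 := isNonarchimedean_spectralNorm (K := ℚ_[p]) (σ (τ x) - τ x) (τ x - x)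
    rw [sub_add_sub_cancel] at h3
    exact h3.trans_lt (max_lt h1 h2)
  inv_mem' {σ} hσ x hx := by
    have := isAlgebraic_algebraicClosure p K
    have h1 := hσ (σ⁻¹ x) (by rw [spectralNorm_absGal]; exact hx)
    rw [← spectralNorm_neg (Algebra.IsAlgebraic.isAlgebraic _), neg_sub] at h1
    have e : σ (σ⁻¹ x) = x := σ.apply_symm_apply x
    rwa [e] at h1

/-- `σ` is a geometric Frobenius element: its inverse induces `x ↦ x ^ q` on the
residue field of the algebraic closure, where `q` is the order of the residue field of `K`. -/
def IsGeomFrob (σ : absGal K) : Prop :=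
  ∀ x : AlgebraicClosure K, spectralNorm ℚ_[p] (AlgebraicClosure K) x ≤ 1 →
    spectralNorm ℚ_[p] (AlgebraicClosure K) (σ⁻¹ x - x ^ Nat.card (resField p K)) < 1

end Fields

/-! ### Representations over rings of integers -/

section Representations

/-- Continuity of a representation, for the `p`-adic topology on the module. -/
def IsContRep (p : ℕ) {R G X : Type*} [CommRing R] [Group G] [TopologicalSpace G]
    [AddCommGroup X] [Module R X] (ρ : Representation R G X) : Prop :=
  letI : TopologicalSpace X := (Ideal.span {(p : R)}).adicModuleTopology X
  Continuous fun z : G × X => ρ z.1 z.2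

/-- The free module of rank one `R(ψ)` on which `G` acts through the character `ψ`. -/
def charRep {R G : Type*} [CommRing R] [Group G] (ψ : G →* Rˣ) : Representation R G R where
  toFun g := LinearMap.lsmul R R (ψ g : R)
  map_one' := by ext; simp
  map_mul' g h := by ext; simp

/-- The representation `X ⊗ R(ψ)`. -/
abbrev twist {R G X : Type*} [CommRing R] [Group G] [AddCommGroup X] [Module R X]
    (ρ : Representation R G X) (ψ : G →* Rˣ) : Representation R G (X ⊗[R] R) :=
  ρ.tprod (charRep ψ)

/-- The representation `X ⊗ N`, where `G` acts trivially on the `R`-module `N`. -/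
abbrev tensorTriv {R G X : Type*} [CommRing R] [Group G] [AddCommGroup X] [Module R X]
    (ρ : Representation R G X) (N : Type*) [AddCommGroup N] [Module R N] :
    Representation R G (X ⊗[R] N) :=
  ρ.tprod (Representation.trivial R G N)

/-- `X` is realisable over `S → R`: it is the extension of scalars of a representation of `G` on
a finite free `S`-module. -/
def IsRealisableOver (S : Type*) {R G X : Type*} [CommRing S] [CommRing R] [Algebra S R] [Group G]
    [AddCommGroup X] [Module R X] (ρ : Representation R G X) : Prop :=
  ∃ (n : ℕ) (ρ₀ : Representation S G (Fin n → S)) (e : (R ⊗[S] (Fin n → S)) ≃ₗ[R] X),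
    ∀ g a x, e (a ⊗ₜ[S] ρ₀ g x) = ρ g (e (a ⊗ₜ[S] x))

theorem IsContRep.eventually {p : ℕ} {R G X : Type*} [CommRing R] [Group G] [TopologicalSpace G]
    [AddCommGroup X] [Module R X] {ρ : Representation R G X} (h : IsContRep p ρ) (x : X) (m : ℕ)
    (g₀ : G) : ∀ᶠ g in nhds g₀, ∃ y : X, ρ g x - ρ g₀ x = (p : R) ^ m • y := by
  let J := Ideal.span {(p : R)}
  let _ : TopologicalSpace R := J.adic_basis.topology
  let _ : TopologicalSpace X := J.adicModuleTopology X
  have hc : Continuous fun z : G × X => ρ z.1 z.2 := h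
  have hc' : Continuous fun g : G => ρ g x := hc.comp (Continuous.prodMk_left x)
  have hmem : {y : X | y - ρ g₀ x ∈ J ^ m • (⊤ : Submodule R X)} ∈ nhds (ρ g₀ x) := by
    have hb := (J.ringFilterBasis.moduleFilterBasis
      (J.adic_module_basis X)).toAddGroupFilterBasis.nhds_hasBasis (ρ g₀ x)
    refine hb.mem_iff.2 ⟨(J ^ m • (⊤ : Submodule R X) : Submodule R X), ⟨m, rfl⟩, ?_⟩
    rintro _ ⟨y, hy, rfl⟩
    simpa using hy
  filter_upwards [hc'.continuousAt.preimage_mem_nhds hmem] with g hg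
  have hg' : ρ g x - ρ g₀ x ∈ J ^ m • (⊤ : Submodule R X) := hg
  rw [Ideal.span_singleton_pow, Submodule.ideal_span_singleton_smul] at hg'
  obtain ⟨y, -, hy⟩ := Submodule.mem_smul_pointwise_iff_exists _ _ _ |>.1 hg'
  exact ⟨y, hy.symm⟩

end Representations

/-! ### The map from `H⁰(G, X(ψ) ⊗ F/O)` to `H¹(G, X ⊗ 𝔽)` -/

section DeltaDual

variable (p : ℕ) [Fact p.Prime]
  {F : Type*} [Field F] [Algebra ℚ_[p] F] [FiniteDimensional ℚ_[p] F]

/-- The `O`-module `F/O`. -/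
abbrev FmodO (F : Type*) [Field F] [Algebra ℚ_[p] F] [FiniteDimensional ℚ_[p] F] : Type _ :=
  F ⧸ LinearMap.range (Algebra.linearMap (integers p F) F)

variable {G X : Type*} [Group G] [TopologicalSpace G] [AddCommGroup X] [Module (integers p F) X]

theorem exists_pow_smul (f : F) : ∃ (n : ℕ) (a : integers p F), (p : F) ^ n * f = a := by
  have hp : spectralNorm ℚ_[p] F (p : F) < 1 := by
    have := spectralNorm_extends (K := ℚ_[p]) (L := F) (p : ℚ_[p])
    rw [map_natCast] at this
    rw [this]
    exact Padic.norm_p_lt_one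
  have hlim := (tendsto_pow_atTop_nhds_zero_of_lt_one (spectralNorm_nonneg (p : F)) hp).mul_const
    (spectralNorm ℚ_[p] F f)
  rw [zero_mul] at hlim
  obtain ⟨n, hn⟩ := (hlim.eventually_le_const zero_lt_one).exists
  refine ⟨n, ⟨(p : F) ^ n * f, ?_⟩, rfl⟩
  have h1 := map_mul (spectralMulAlgNorm ℚ_[p] F) ((p : F) ^ n) f
  rw [map_pow] at h1
  simp only [spectralMulAlgNorm_def] at h1
  change spectralNorm ℚ_[p] F _ ≤ 1
  rw [h1]
  exact hn

/-- The inclusion of `X(ψ)` into `X(ψ) ⊗ F`. -/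
def toF (A : Type*) [AddCommGroup A] [Module (integers p F) A] :
    A →ₗ[integers p F] A ⊗[integers p F] F :=
  (TensorProduct.mk (integers p F) A F).flip 1

/-- The projection of `X(ψ) ⊗ F` onto `X(ψ) ⊗ F/O`. -/
def toFmodO (A : Type*) [AddCommGroup A] [Module (integers p F) A] :
    A ⊗[integers p F] F →ₗ[integers p F] A ⊗[integers p F] FmodO p F :=
  LinearMap.lTensor A (Submodule.mkQ _)

/-- The reduction map from the module `X ⊗ O` underlying `X(ψ)` to `X ⊗ 𝔽`. -/
def reduction (X : Type*) [AddCommGroup X] [Module (integers p F) X] :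
    X ⊗[integers p F] (integers p F) →ₗ[integers p F] X ⊗[integers p F] resField p F :=
  LinearMap.lTensor X (Algebra.linearMap _ _)

variable {p}

theorem twist_eventually {ρ : Representation (integers p F) G X} {ψ : G →* (integers p F)ˣ}
    (hρ : IsContRep p ρ) (hψ : IsContRep p (charRep ψ)) (a : X ⊗[integers p F] (integers p F))
    (m : ℕ) (g₀ : G) :
    ∀ᶠ g in nhds g₀, ∃ y, twist ρ ψ g a - twist ρ ψ g₀ a = (p : integers p F) ^ m • y := by
  induction a with
  | zero => exact .of_forall fun g => ⟨0, by simp⟩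
  | add a b ha hb =>
    filter_upwards [ha, hb] with g hg hg'
    obtain ⟨y, hy⟩ := hg
    obtain ⟨z, hz⟩ := hg'
    refine ⟨y + z, ?_⟩
    rw [smul_add, ← hy, ← hz, map_add, map_add]
    abel
  | tmul x s =>
    filter_upwards [hρ.eventually x m g₀, hψ.eventually s m g₀] with g hg hg'
    obtain ⟨y, hy⟩ := hg
    obtain ⟨z, hz⟩ := hg'
    refine ⟨y ⊗ₜ charRep ψ g s + ρ g₀ x ⊗ₜ z, ?_⟩
    rw [smul_add, TensorProduct.smul_tmul', ← hy, ← TensorProduct.tmul_smul, ← hz,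
      TensorProduct.sub_tmul, TensorProduct.tmul_sub]
    simp [Representation.tprod_apply]

theorem exists_pow_smul_tensor {A : Type*} [AddCommGroup A] [Module (integers p F) A]
    (b : A ⊗[integers p F] F) : ∃ (n : ℕ) (a : A), (p : integers p F) ^ n • b = toF p A a := by
  induction b with
  | zero => exact ⟨0, 0, by simp⟩
  | add b c hb hc =>
    obtain ⟨n, a, ha⟩ := hb
    obtain ⟨m, d, hd⟩ := hc
    refine ⟨n + m, (p : integers p F) ^ m • a + (p : integers p F) ^ n • d, ?_⟩
    rw [map_add, map_smul, map_smul, ← ha, ← hd, smul_add, smul_smul, smul_smul, ← pow_add,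
      ← pow_add, add_comm m n]
  | tmul x f =>
    obtain ⟨n, a, ha⟩ := exists_pow_smul p f
    refine ⟨n, a • x, ?_⟩
    have e : (p : integers p F) ^ n • f = a • (1 : F) := by
      rw [Algebra.smul_def, Algebra.smul_def, mul_one, map_pow, map_natCast, ha]
      rfl
    change _ = (a • x) ⊗ₜ[integers p F] (1 : F)
    rw [← TensorProduct.tmul_smul, e, TensorProduct.tmul_smul, TensorProduct.smul_tmul']

theorem toF_eq (A : Type*) [AddCommGroup A] [Module (integers p F) A] (a : A) :
    toF p A a = LinearMap.lTensor A (Algebra.linearMap (integers p F) F)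
      ((TensorProduct.rid (integers p F) A).symm a) := by
  simp [toF]

theorem toF_injective (A : Type*) [AddCommGroup A] [Module (integers p F) A]
    [Module.Flat (integers p F) A] : Function.Injective (toF p (F := F) A) := by
  have h : Function.Injective (Algebra.linearMap (integers p F) F) := Subtype.val_injective
  have h' := Module.Flat.lTensor_preserves_injective_linearMap (M := A) _ h
  intro a b hab
  rw [toF_eq, toF_eq] at hab
  exact (TensorProduct.rid (integers p F) A).symm.injective (h' hab)

theorem toF_exact (A : Type*) [AddCommGroup A] [Module (integers p F) A] :
    Function.Exact (toF p (F := F) A) (toFmodO p A) := by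
  have h : Function.Exact (Algebra.linearMap (integers p F) F)
      (LinearMap.range (Algebra.linearMap (integers p F) F)).mkQ :=
    LinearMap.exact_map_mkQ_range _
  have h' := lTensor_exact A h (Submodule.mkQ_surjective _)
  intro b
  refine (h' b).trans ⟨?_, ?_⟩
  · rintro ⟨c, rfl⟩
    refine ⟨TensorProduct.rid (integers p F) A c, ?_⟩
    rw [toF_eq, LinearEquiv.symm_apply_apply]
  · rintro ⟨a, rfl⟩
    exact ⟨_, (toF_eq A a).symm⟩

theorem natCast_prime_resField :
    (algebraMap (integers p F) (resField p F)) (p : integers p F) = 0 := by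
  change IsLocalRing.residue _ _ = 0
  rw [IsLocalRing.residue_eq_zero_iff, IsLocalRing.mem_maximalIdeal, mem_nonunits_iff]
  rintro ⟨u, hu⟩
  have h1 : spectralNorm ℚ_[p] F ((u⁻¹ : (integers p F)ˣ) : integers p F).1 ≤ 1 :=
    ((u⁻¹ : (integers p F)ˣ) : integers p F).2
  have h2 : (p : F) * ((u⁻¹ : (integers p F)ˣ) : integers p F).1 = 1 := by
    have := congrArg Subtype.val (u.mul_inv)
    rw [hu] at this
    exact this
  have hp : spectralNorm ℚ_[p] F (p : F) < 1 := by
    have := spectralNorm_extends (K := ℚ_[p]) (L := F) (p : ℚ_[p])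
    rw [map_natCast] at this
    rw [this]
    exact Padic.norm_p_lt_one
  have h3 := map_mul (spectralMulAlgNorm ℚ_[p] F) (p : F)
    ((u⁻¹ : (integers p F)ˣ) : integers p F).1
  rw [h2] at h3
  simp only [spectralMulAlgNorm_def, spectralNorm_one] at h3
  have := mul_lt_one_of_nonneg_of_lt_one_left (spectralNorm_nonneg (p : F)) hp h1
  linarith

theorem reduction_smul_eq_zero (a : X ⊗[integers p F] (integers p F)) :
    reduction p X ((p : integers p F) • a) = 0 := by
  rw [map_smul]
  induction reduction p X a with
  | zero => simp
  | add b c hb hc => rw [smul_add, hb, hc, add_zero]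
  | tmul x f =>
    rw [← TensorProduct.tmul_smul, Algebra.smul_def, natCast_prime_resField, zero_mul,
      TensorProduct.tmul_zero]

variable [Module.Free (integers p F) X]

/-- The exact sequence `0 → X(ψ) → X(ψ) ⊗ F → X(ψ) ⊗ F/O → 0` and the reduction map
`X(ψ) → X(ψ) ⊗ 𝔽 = X ⊗ 𝔽`, which is equivariant as `ψ` is residually trivial. -/
theorem connectingData {ρ : Representation (integers p F) G X} {ψ : G →* (integers p F)ˣ}
    (hρ : IsContRep p ρ) (hψ : IsContRep p (charRep ψ))
    (hres : ∀ g, IsLocalRing.residue (integers p F) (ψ g) = 1) :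
    ConnectingData (twist ρ ψ) (tensorTriv (twist ρ ψ) F) (tensorTriv (twist ρ ψ) (FmodO p F))
      (tensorTriv ρ (resField p F)) (toF p _) (toFmodO p _) (reduction p X) where
  i_equiv g a := by simp [toF]
  q_equiv g b := by
    induction b with
    | zero => simp
    | add b c hb hc => simp only [map_add, hb, hc]
    | tmul x f => simp [toFmodO]
  r_equiv g a := by
    induction a with
    | zero => simp
    | add b c hb hc => simp only [map_add, hb, hc]
    | tmul x s =>
      simp [reduction, charRep, hres g]
  inj := toF_injective _
  exact := toF_exact _
  surj := LinearMap.lTensor_surjective _ (Submodule.mkQ_surjective _)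
  cont b c hc := by
    obtain ⟨n, a, ha⟩ := exists_pow_smul_tensor b
    have key : ∀ g, (p : integers p F) ^ n • c g = twist ρ ψ g a - a := fun g => by
      apply toF_injective (p := p) (F := F)
      have e : toF p _ (twist ρ ψ g a) = tensorTriv (twist ρ ψ) F g (toF p _ a) := by simp [toF]
      rw [map_smul, hc, map_sub, e, ← ha, map_smul, smul_sub]
    refine (IsLocallyConstant.iff_eventually_eq _).2 fun g₀ => ?_
    filter_upwards [twist_eventually hρ hψ a (n + 1) g₀] with g hg
    obtain ⟨y, hy⟩ := hg
    have hp0 : (p : integers p F) ^ n ≠ 0 := by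
      refine pow_ne_zero _ fun h => ?_
      have h' : ((p : integers p F) : F) = 0 := by rw [h]; rfl
      have : CharZero F := charZero_of_injective_algebraMap (algebraMap ℚ_[p] F).injective
      have h'' : (p : F) = 0 := h'
      exact (Fact.out : p.Prime).ne_zero (Nat.cast_eq_zero.1 h'')
    have e : c g - c g₀ = (p : integers p F) • y := by
      apply smul_right_injective _ hp0
      change _ • _ = _ • _
      rw [smul_sub, key, key, smul_smul, ← pow_succ, ← hy]
      abel
    rw [← sub_eq_zero, ← map_sub, e, reduction_smul_eq_zero]

/-- The map `H⁰(G, X(ψ) ⊗ F/O) → H¹(G, X ⊗ 𝔽)`: the connecting map of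
`0 → X(ψ) → X(ψ) ⊗ F → X(ψ) ⊗ F/O → 0` followed by reduction, for a residually trivial
character `ψ`. -/
def deltaDual {ρ : Representation (integers p F) G X} {ψ : G →* (integers p F)ˣ}
    (hρ : IsContRep p ρ) (hψ : IsContRep p (charRep ψ))
    (hres : ∀ g, IsLocalRing.residue (integers p F) (ψ g) = 1) :
    (tensorTriv (twist ρ ψ) (FmodO p F)).invariants →ₗ[integers p F]
      H1 (tensorTriv ρ (resField p F)) :=
  (connectingData hρ hψ hres).delta

end DeltaDual

/-- The subspace `H¹_ur(G_K, M)` of unramified classes: the kernel of restriction to `I_K`. -/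
def H1ur (p : ℕ) [Fact p.Prime] {K : Type*} [Field K] [Algebra ℚ_[p] K]
    [Algebra.IsAlgebraic ℚ_[p] K] {R M : Type*} [CommRing R] [AddCommGroup M] [Module R M]
    (ρ : Representation R (absGal K) M) : Submodule R (H1 ρ) :=
  LinearMap.ker (H1res ρ (inertia p K))

end GalTwist

end

/-! By density of the group generated by `I` and `Φ = Frob_K`, a cocycle is determined by its values
on `I` and at `Φ`. Twisting the characteristic polynomial of `Φ` on `X₀` gives a polynomial `P`
that kills `Φ` on `X(ψ)`, and `c = P(1)` lies in `(Φ - 1) · O[Φ]`. Here `c = Q(ψ(Φ)⁻¹)` with `Q`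
monic over `O_E` of degree `n = rank X`. Modulo `ϖ`, such a `Q` is `(T - 1) ^ j`, with `j ≤ n`,
times a polynomial that is a unit at `ψ(Φ)⁻¹`, so `ϖ ∣ c` would force `ϖ ∣ (ψ(Φ) - 1) ^ n`. As
`v_E(ψ(Φ) - 1) < 1 / n`, this fails, and `ϖ = c m` with `m` in the maximal ideal.

On `I` the twist is invisible and the representation is defined over `O_E`, where `ϖ` is a
uniformiser. Hence, for every ideal `J` containing `ϖ`, the inertia invariants of `X / J X` lift to
those of `X / ϖ X`. With `J = (c)` this shows that `g ↦ g b - b` is a coboundary on `I` modulo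
`m`, so the image of the connecting map is unramified. With `J` the maximal ideal it lifts the
value at `Φ` of an unramified cocycle to some `x` that is inertia invariant modulo `c m`, and the
lift `b` is the solution of `Φ b - b = x`, which exists after inverting `c`.
-/

noncomputable section

namespace GalTwist

/-! ### Cocycles and restriction to a subgroup -/

section Cohomology

variable {R G M : Type*} [CommRing R] [Group G] [TopologicalSpace G] [AddCommGroup M] [Module R M]
  {ρ : Representation R G M} {I : Subgroup G}

theorem Z1.apply_one (c : Z1 ρ) : c.1 1 = 0 := by
  simpa using c.2.2 1 1

theorem Z1.ext_of_dense {c d : Z1 ρ} {Φ : G}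
    (hdense : Dense ((I ⊔ Subgroup.zpowers Φ : Subgroup G) : Set G))
    (hI : ∀ g ∈ I, c.1 g = d.1 g) (hΦ : c.1 Φ = d.1 Φ) : c = d := by
  let H : Subgroup G :=
    { carrier := {g | (c - d).1 g = 0}
      one_mem' := Z1.apply_one _
      mul_mem' := fun {g h} hg hh => by
        simp only [Set.mem_ofPred_eq] at hg hh ⊢
        rw [(c - d).2.2, hg, hh, map_zero, add_zero]
      inv_mem' := fun {g} hg => by
        simp only [Set.mem_ofPred_eq] at hg ⊢
        simpa [Z1.apply_one, hg] using ((c - d).2.2 g⁻¹ g).symm }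
  have hclosed : IsClosed (H : Set G) := (c - d).2.1.isClosed_fiber 0
  have hle : I ⊔ Subgroup.zpowers Φ ≤ H :=
    sup_le (fun g hg => sub_eq_zero.2 (hI g hg))
      ((Subgroup.zpowers_le).2 (sub_eq_zero.2 hΦ))
  have huniv : (H : Set G) = Set.univ :=
    Set.univ_subset_iff.1 (hdense.closure_eq ▸ closure_minimal hle hclosed)
  exact Subtype.ext (funext fun g => sub_eq_zero.1 (huniv ▸ Set.mem_univ g : g ∈ (H : Set G)))

theorem Z1.apply_mem_invariants [I.Normal] {c : Z1 ρ} (hc : ∀ g ∈ I, c.1 g = 0) (Φ : G) :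
    c.1 Φ ∈ (resRep ρ I).invariants := by
  intro g
  have hconj : (Φ⁻¹ * g * Φ : G) ∈ I := by
    simpa using Subgroup.Normal.conj_mem ‹I.Normal› g g.2 Φ⁻¹
  have hleft := c.2.2 g Φ
  have hright := c.2.2 Φ (Φ⁻¹ * g * Φ)
  rw [hc _ g.2, zero_add] at hleft
  rw [hc _ hconj, map_zero, add_zero, show Φ * (Φ⁻¹ * g * Φ) = g * Φ by group] at hright
  exact hleft.symm.trans hright

/-- The cocycle `g ↦ g m - m`, for an element `m` with locally constant orbit map. -/
def coboundary (ρ : Representation R G M) (m : M) (hm : IsLocallyConstant fun g => ρ g m) :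
    Z1 ρ :=
  ⟨fun g => ρ g m - m, hm.comp (· - m), fun g h => by
    simp only [map_mul, Module.End.mul_apply, map_sub]
    abel⟩

theorem coboundary_mem_B1 (m : M) (hm : IsLocallyConstant fun g => ρ g m) :
    coboundary ρ m hm ∈ B1 ρ :=
  ⟨m, fun _ => rfl⟩

theorem mem_invariants_of_dense {m : M} {Φ : G} (hm : IsLocallyConstant fun g => ρ g m)
    (hdense : Dense ((I ⊔ Subgroup.zpowers Φ : Subgroup G) : Set G))
    (hI : ∀ g ∈ I, ρ g m = m) (hΦ : ρ Φ m = m) : m ∈ ρ.invariants := by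
  have hzero : coboundary ρ m hm = 0 :=
    Z1.ext_of_dense hdense (fun g hg => sub_eq_zero.2 (hI g hg)) (sub_eq_zero.2 hΦ)
  exact fun g => sub_eq_zero.1 (congrFun (congrArg Subtype.val hzero) g)

theorem mk_mem_ker_H1res_iff (c : Z1 ρ) :
    (Submodule.Quotient.mk c : H1 ρ) ∈ LinearMap.ker (H1res ρ I) ↔
      ∃ m, ∀ g ∈ I, c.1 g = ρ g m - m := by
  rw [LinearMap.mem_ker]
  change (Submodule.Quotient.mk (Z1res ρ I c) : H1 (resRep ρ I)) = 0 ↔ _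
  rw [Submodule.Quotient.mk_eq_zero]
  exact ⟨fun ⟨m, hm⟩ => ⟨m, fun g hg => hm ⟨g, hg⟩⟩, fun ⟨m, hm⟩ => ⟨m, fun g => hm g g.2⟩⟩

variable {R' M' : Type*} [CommRing R'] [AddCommGroup M'] [Module R' M']
  {ρ' : Representation R' G M'}

theorem H1map_mem_ker_H1res (f : M →+ M') (hf : ∀ g m, f (ρ g m) = ρ' g (f m)) {x : H1 ρ}
    (hx : x ∈ LinearMap.ker (H1res ρ I)) : H1map ρ ρ' f hf x ∈ LinearMap.ker (H1res ρ' I) := by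
  obtain ⟨c, rfl⟩ := Submodule.Quotient.mk_surjective _ x
  obtain ⟨m, hm⟩ := (mk_mem_ker_H1res_iff c).1 hx
  refine (mk_mem_ker_H1res_iff (Z1map ρ ρ' f hf c)).2 ⟨f m, fun g hg => ?_⟩
  rw [← hf, ← map_sub, ← hm g hg]
  rfl

theorem map_H1map_ker_H1res (φ : M ≃+ M')
    (hφ : ∀ g m, φ.toAddMonoidHom (ρ g m) = ρ' g (φ.toAddMonoidHom m)) :
    (LinearMap.ker (H1res ρ I)).toAddSubgroup.map (H1map ρ ρ' φ.toAddMonoidHom hφ) =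
      (LinearMap.ker (H1res ρ' I)).toAddSubgroup := by
  have hφsymm : ∀ g m, φ.symm.toAddMonoidHom (ρ' g m) = ρ g (φ.symm.toAddMonoidHom m) := by
    intro g m
    refine φ.injective ((φ.apply_symm_apply _).trans ?_)
    exact ((hφ g (φ.symm m)).trans (congrArg (ρ' g) (φ.apply_symm_apply m))).symm
  refine le_antisymm ?_ fun x hx => ⟨H1map ρ' ρ φ.symm.toAddMonoidHom hφsymm x,
    H1map_mem_ker_H1res _ hφsymm hx, ?_⟩
  · rintro _ ⟨x, hx, rfl⟩
    exact H1map_mem_ker_H1res _ hφ hx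
  · obtain ⟨c, rfl⟩ := Submodule.Quotient.mk_surjective _ x
    exact congrArg Submodule.Quotient.mk
      (Subtype.ext (funext fun g => φ.apply_symm_apply (c.1 g)))

end Cohomology

/-! ### Invariants modulo a submodule -/

section InvariantsMod

variable {R G A : Type*} [CommRing R] [Group G] [AddCommGroup A] [Module R A]

/-- The vectors fixed by the group modulo `N`. The submodule `N` need not be stable. -/
def invariantsMod (ρ : Representation R G A) (N : Submodule R A) : Submodule R A :=
  ⨅ g, N.comap (ρ g - 1)

theorem mem_invariantsMod {ρ : Representation R G A} {N : Submodule R A} {x : A} :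
    x ∈ invariantsMod ρ N ↔ ∀ g, ρ g x - x ∈ N := by
  simp [invariantsMod]

theorem aeval_mem_invariantsMod_resRep {ρ : Representation R G A} {I : Subgroup G} [I.Normal]
    {J : Ideal R} {x : A} (hx : x ∈ invariantsMod (resRep ρ I) (J • ⊤)) (Φ : G)
    (q : Polynomial R) :
    Polynomial.aeval (ρ Φ) q x ∈ invariantsMod (resRep ρ I) (J • ⊤) := by
  refine Polynomial.aeval_apply_smul_mem_of_le_comap hx q (ρ Φ) fun y hy => ?_
  refine mem_invariantsMod.2 fun g => ?_
  have hconj : (Φ⁻¹ * g * Φ : G) ∈ I := by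
    simpa using Subgroup.Normal.conj_mem ‹I.Normal› g g.2 Φ⁻¹
  have hfix : ρ Φ (ρ (Φ⁻¹ * g * Φ) y - y) = ρ g (ρ Φ y) - ρ Φ y := by
    rw [map_sub, ← Module.End.mul_apply, ← Module.End.mul_apply, ← map_mul, ← map_mul]
    congr 3
    group
  exact hfix ▸ Submodule.smul_top_le_comap_smul_top J (ρ Φ)
    (mem_invariantsMod.1 hy ⟨_, hconj⟩)

theorem mem_span_singleton_smul_top {a : R} {x : A} :
    x ∈ Ideal.span {a} • (⊤ : Submodule R A) ↔ ∃ y, a • y = x := by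
  simp [Submodule.ideal_span_singleton_smul, Submodule.mem_smul_pointwise_iff_exists]

end InvariantsMod

/-! ### The image of a connecting map -/

namespace ConnectingData

variable {R G A B C D : Type*} [CommRing R] [Group G] [TopologicalSpace G]
  [AddCommGroup A] [Module R A] [AddCommGroup B] [Module R B]
  [AddCommGroup C] [Module R C] [AddCommGroup D] [Module R D]
  {ρA : Representation R G A} {ρB : Representation R G B}
  {ρC : Representation R G C} {ρD : Representation R G D}
  {i : A →ₗ[R] B} {q : B →ₗ[R] C} {r : A →ₗ[R] D} {I : Subgroup G} {Φ : G} {c m : R}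

theorem smul_eq_of_mul_eq_smul_one (h : ConnectingData ρA ρB ρC ρD i q r) {T : Module.End R A}
    (hT : T * (ρA Φ - 1) = c • 1)
    (htors : ∀ b : B, ∃ s : R, Function.Injective (fun b : B => s • b) ∧ ∃ a, i a = s • b)
    {b : B} {a : A} (ha : i a = ρB Φ b - b) : c • b = i (T a) := by
  obtain ⟨s, hs, a', ha'⟩ := htors b
  have hsa : s • a = (ρA Φ - 1) a' := h.inj <| by
    simp [h.i_equiv, ha, ha', smul_sub]
  refine hs ?_
  calc s • c • b = i (c • a') := by rw [map_smul, ha', smul_comm]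
    _ = i (T ((ρA Φ - 1) a')) := by rw [← Module.End.mul_apply, hT]; rfl
    _ = s • i (T a) := by rw [← hsa, map_smul, map_smul]

theorem range_delta_le_ker_H1res (h : ConnectingData ρA ρB ρC ρD i q r) {T : Module.End R A}
    (hT : T * (ρA Φ - 1) = c • 1)
    (htors : ∀ b : B, ∃ s : R, Function.Injective (fun b : B => s • b) ∧ ∃ a, i a = s • b)
    (hc : Function.Injective fun b : B => c • b)
    (hr : ∀ a, r (m • a) = 0)
    (hlift : invariantsMod (resRep ρA I) (Ideal.span {c} • ⊤) ≤
      invariantsMod (resRep ρA I) (Ideal.span {c * m} • ⊤) ⊔ Ideal.span {c} • ⊤) :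
    LinearMap.range h.delta ≤ LinearMap.ker (H1res ρD I) := by
  rintro _ ⟨x, rfl⟩
  obtain ⟨b, hb⟩ := h.surj x.1
  have hqb : q b ∈ ρC.invariants := hb ▸ x.2
  choose a ha using h.exists_cochain b hqb
  have hcb : c • b = i (T (a Φ)) := h.smul_eq_of_mul_eq_smul_one hT htors (ha Φ)
  have hcA : Function.Injective fun a : A => c • a := fun a a' haa' =>
    h.inj (hc (by simpa only [map_smul] using congrArg i haa'))
  have hca : ∀ g, c • a g = ρA g (T (a Φ)) - T (a Φ) := fun g => h.inj <| by
    rw [map_smul, ha, map_sub, h.i_equiv, ← hcb, map_smul, smul_sub]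
  have hmem : T (a Φ) ∈ invariantsMod (resRep ρA I) (Ideal.span {c} • ⊤) :=
    mem_invariantsMod.2 fun g => mem_span_singleton_smul_top.2 ⟨a g, hca g⟩
  obtain ⟨y, hy, _, hz, hyz⟩ := Submodule.mem_sup.1 (hlift hmem)
  obtain ⟨z, rfl⟩ := mem_span_singleton_smul_top.1 hz
  rw [h.delta_eq x b hb, mk_mem_ker_H1res_iff]
  refine ⟨r z, fun g hg => ?_⟩
  obtain ⟨w, hw⟩ := mem_span_singleton_smul_top.1 (mem_invariantsMod.1 hy ⟨g, hg⟩)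
  have hag : a g = ρA g z - z + m • w := by
    refine hcA ?_
    simp only [smul_add, smul_smul, hw, hca, ← hyz, MonoidHom.comp_apply, Subgroup.subtype_apply,
      map_add, map_smul, smul_sub]
    abel
  rw [h.cocycle_eq b hqb g (a g) (ha g), hag, map_add, hr, add_zero, map_sub, h.r_equiv]

theorem exists_cocycle_eq (h : ConnectingData ρA ρB ρC ρD i q r)
    (hdense : Dense ((I ⊔ Subgroup.zpowers Φ : Subgroup G) : Set G)) {T : Module.End R A}
    (hT : (ρA Φ - 1) * T = c • 1)
    (hc : Function.Bijective fun b : B => c • b) (hr : ∀ a, r (m • a) = 0)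
    (hC : ∀ x, IsLocallyConstant fun g => ρC g x) {x : A}
    (hx : T x ∈ invariantsMod (resRep ρA I) (Ideal.span {c * m} • ⊤))
    {w : Z1 ρD} (hwI : ∀ g ∈ I, w.1 g = 0) (hwΦ : w.1 Φ = r x) :
    ∃ (b : B) (hb : q b ∈ ρC.invariants), h.cocycle b hb = w := by
  obtain ⟨b, hb : c • b = i (T x)⟩ := hc.2 (i (T x))
  have hbΦ : i x = ρB Φ b - b := hc.1 <| by
    have hcx : c • x = ρA Φ (T x) - T x := (LinearMap.congr_fun hT x).symm
    change c • i x = c • (ρB Φ b - b)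
    rw [← map_smul, hcx, map_sub, h.i_equiv, ← hb, map_smul, smul_sub]
  have hbI : ∀ g ∈ I, ∃ z, i (m • z) = ρB g b - b := fun g hg => by
    obtain ⟨z, hz⟩ := mem_span_singleton_smul_top.1 (mem_invariantsMod.1 hx ⟨g, hg⟩)
    refine ⟨z, hc.1 ?_⟩
    change c • i (m • z) = c • (ρB g b - b)
    rw [← map_smul, smul_smul, hz, map_sub, smul_sub, ← map_smul (ρB g), hb, ← h.i_equiv]
    rfl
  have hfix : ∀ {g a}, i a = ρB g b - b → ρC g (q b) = q b := fun {g a} ha => by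
    rw [← sub_eq_zero, ← h.q_equiv, ← map_sub, ← ha, h.exact.apply_apply_eq_zero]
  have hqb : q b ∈ ρC.invariants :=
    mem_invariants_of_dense (hC (q b)) hdense (fun g hg => hfix (hbI g hg).choose_spec) (hfix hbΦ)
  refine ⟨b, hqb, Z1.ext_of_dense hdense (fun g hg => ?_) ?_⟩
  · obtain ⟨z, hz⟩ := hbI g hg
    rw [h.cocycle_eq b hqb g _ hz, hr, hwI g hg]
  · rw [h.cocycle_eq b hqb Φ x hbΦ, hwΦ]

theorem ker_H1res_le_range_delta (h : ConnectingData ρA ρB ρC ρD i q r) [I.Normal]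
    (hdense : Dense ((I ⊔ Subgroup.zpowers Φ : Subgroup G) : Set G)) {T : Polynomial R}
    (hT : (ρA Φ - 1) * Polynomial.aeval (ρA Φ) T = c • 1)
    (hc : Function.Bijective fun b : B => c • b) {J : Ideal R} (hm : m ∈ J)
    (hker : LinearMap.ker r = J • ⊤) (hr : Function.Surjective r)
    (hC : ∀ x, IsLocallyConstant fun g => ρC g x) (hD : ∀ x, IsLocallyConstant fun g => ρD g x)
    (hlift : invariantsMod (resRep ρA I) (J • ⊤) ≤
      invariantsMod (resRep ρA I) (Ideal.span {c * m} • ⊤) ⊔ J • ⊤) :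
    LinearMap.ker (H1res ρD I) ≤ LinearMap.range h.delta := by
  intro ξ hξ
  obtain ⟨w, rfl⟩ := Submodule.Quotient.mk_surjective _ ξ
  obtain ⟨d, hd⟩ := (mk_mem_ker_H1res_iff w).1 hξ
  have hwI : ∀ g ∈ I, (w - coboundary ρD d (hD d)).1 g = 0 := fun g hg => sub_eq_zero.2 (hd g hg)
  obtain ⟨x, hx⟩ := hr ((w - coboundary ρD d (hD d)).1 Φ)
  have hxI : x ∈ invariantsMod (resRep ρA I) (J • ⊤) := mem_invariantsMod.2 fun g => by
    rw [← hker, LinearMap.mem_ker, map_sub, sub_eq_zero]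
    exact (h.r_equiv g x).trans (hx ▸ Z1.apply_mem_invariants hwI Φ g)
  obtain ⟨y, hy, z, hz, hyz⟩ := Submodule.mem_sup.1 (hlift hxI)
  rw [← hyz, map_add, LinearMap.mem_ker.1 (hker.ge hz), add_zero] at hx
  have hrm : ∀ a, r (m • a) = 0 := fun a =>
    LinearMap.mem_ker.1 (hker ▸ Submodule.smul_mem_smul hm Submodule.mem_top)
  obtain ⟨b, hb, hcoc⟩ := h.exists_cocycle_eq hdense hT hc hrm hC
    (aeval_mem_invariantsMod_resRep hy Φ T) hwI hx.symm
  refine ⟨⟨q b, hb⟩, ?_⟩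
  rw [h.delta_eq _ b rfl, hcoc, Submodule.Quotient.eq, sub_sub_cancel_left]
  exact neg_mem (coboundary_mem_B1 d (hD d))

theorem range_delta_eq_ker_H1res (h : ConnectingData ρA ρB ρC ρD i q r) [I.Normal]
    (hdense : Dense ((I ⊔ Subgroup.zpowers Φ : Subgroup G) : Set G)) {P : Polynomial R}
    (hP : Polynomial.aeval (ρA Φ) P = 0)
    (htors : ∀ b : B, ∃ s : R, Function.Injective (fun b : B => s • b) ∧ ∃ a, i a = s • b)
    (hc : Function.Bijective fun b : B => P.eval 1 • b) {J : Ideal R} (hm : m ∈ J)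
    (hker : LinearMap.ker r = J • ⊤) (hr : Function.Surjective r)
    (hC : ∀ x, IsLocallyConstant fun g => ρC g x) (hD : ∀ x, IsLocallyConstant fun g => ρD g x)
    (hlift : ∀ J' : Ideal R, P.eval 1 * m ∈ J' →
      invariantsMod (resRep ρA I) (J' • ⊤) ≤
        invariantsMod (resRep ρA I) (Ideal.span {P.eval 1 * m} • ⊤) ⊔ J' • ⊤) :
    LinearMap.range h.delta = LinearMap.ker (H1res ρD I) := by
  obtain ⟨T, hT⟩ := Polynomial.X_sub_C_dvd_sub_C_eval (a := 1) (p := P)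
  have hleft : (ρA Φ - 1) * Polynomial.aeval (ρA Φ) (-T) = P.eval 1 • 1 := by
    simpa [hP, Algebra.algebraMap_eq_smul_one] using
      (congrArg (fun f => - Polynomial.aeval (ρA Φ) f) hT).symm
  have hcomm : Polynomial.aeval (ρA Φ) (-T) * (ρA Φ - 1) = P.eval 1 • 1 := by
    simpa [hP, Algebra.algebraMap_eq_smul_one] using
      (congrArg (fun f => - Polynomial.aeval (ρA Φ) f) (hT.trans (mul_comm _ _))).symm
  refine le_antisymm (h.range_delta_le_ker_H1res hcomm htors hc.1 (fun a => ?_)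
      (hlift _ (Ideal.mul_mem_right _ _ (Ideal.mem_span_singleton_self _))))
    (h.ker_H1res_le_range_delta hdense hleft hc hm hker hr hC hD
      (hlift J (Ideal.mul_mem_left _ _ hm)))
  exact LinearMap.mem_ker.1 (hker ▸ Submodule.smul_mem_smul hm Submodule.mem_top)

end ConnectingData

theorem isLocallyConstant_tensorTriv_apply {R G A N : Type*} [CommRing R] [Group G]
    [TopologicalSpace G] [AddCommGroup A] [Module R A] [AddCommGroup N] [Module R N]
    {ρ : Representation R G A} {ϖ : R}
    (hρ : ∀ (a : A) (k : ℕ) (g₀ : G), ∀ᶠ g in nhds g₀, ∃ y, ρ g a - ρ g₀ a = ϖ ^ k • y)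
    (hN : ∀ x : N, ∃ k, ϖ ^ k • x = 0) (z : A ⊗[R] N) :
    IsLocallyConstant fun g => tensorTriv ρ N g z := by
  induction z with
  | zero => simpa only [map_zero] using! IsLocallyConstant.const 0
  | add z w hz hw => simpa only [map_add] using! hz.add hw
  | tmul a x =>
    obtain ⟨k, hk⟩ := hN x
    refine (IsLocallyConstant.iff_eventually_eq _).2 fun g₀ => ?_
    filter_upwards [hρ a k g₀] with g ⟨y, hy⟩
    simp only [Representation.tprod_apply, TensorProduct.map_tmul,
      Representation.trivial_apply]
    rw [← sub_eq_zero, ← TensorProduct.sub_tmul, hy, ← TensorProduct.smul_tmul',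
      ← TensorProduct.tmul_smul, hk, TensorProduct.tmul_zero]

/-! ### Realisable representations -/

section Realisable

theorem exists_linearIndependent_sum_smul {k V ι : Type*} [Field k] [AddCommGroup V] [Module k V]
    [Finite ι] (a : ι → V) :
    ∃ (d : ℕ) (b : Fin d → V) (u : ι → Fin d → k),
      LinearIndependent k b ∧ ∀ i, a i = ∑ j, u i j • b j := by
  have : FiniteDimensional k (Submodule.span k (Set.range a)) :=
    FiniteDimensional.span_of_finite k (Set.finite_range a)
  let basis := Module.finBasis k (Submodule.span k (Set.range a))
  refine ⟨_, fun j => basis j,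
    fun i => basis.repr ⟨a i, Submodule.subset_span (Set.mem_range_self i)⟩,
    basis.linearIndependent.map' _ (Submodule.ker_subtype _), fun i => ?_⟩
  have hsum := congrArg Subtype.val
    (basis.sum_repr ⟨a i, Submodule.subset_span (Set.mem_range_self i)⟩)
  simpa only [Submodule.coe_sum, Submodule.coe_smul] using hsum.symm

variable {S R : Type*} [CommRing S] [CommRing R] [Algebra S R]

theorem exists_sum_smul_mem_of_isMaximal {𝔪 : Ideal S} [𝔪.IsMaximal] {J : Ideal R}
    (hJ : 𝔪 ≤ J.comap (algebraMap S R)) {ι : Type*} [Finite ι] (a : ι → R) :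
    ∃ (d : ℕ) (b : Fin d → R) (u : ι → Fin d → S),
      (∀ i, a i - ∑ j, u i j • b j ∈ J) ∧ ∀ w : Fin d → S, ∑ j, w j • b j ∈ J → ∀ j, w j ∈ 𝔪 := by
  let _ : Field (S ⧸ 𝔪) := Ideal.Quotient.field 𝔪
  let _ : Algebra (S ⧸ 𝔪) (R ⧸ J) := Ideal.Quotient.algebraQuotientOfLEComap hJ
  have hmk : ∀ (s : S) (x : R), (Ideal.Quotient.mk J (s • x)) =
      Ideal.Quotient.mk 𝔪 s • Ideal.Quotient.mk J x := fun s x => by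
    rw [Algebra.smul_def, Algebra.smul_def, map_mul]
    rfl
  obtain ⟨d, b, u, hb, hu⟩ :=
    exists_linearIndependent_sum_smul (k := S ⧸ 𝔪) fun i => Ideal.Quotient.mk J (a i)
  choose b' hb' using fun j => Ideal.Quotient.mk_surjective (b j)
  choose u' hu' using fun i j => Ideal.Quotient.mk_surjective (u i j)
  refine ⟨d, b', u', fun i => ?_, fun w hw j => ?_⟩
  · simp only [← Ideal.Quotient.eq, map_sum, hmk, hb', hu', hu]
  · rw [← Ideal.Quotient.eq_zero_iff_mem] at hw ⊢
    simp only [map_sum, hmk, hb'] at hw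
    exact Fintype.linearIndependent_iff.1 hb _ hw j

theorem exists_sum_tmul_sub_mem {𝔪 : Ideal S} [𝔪.IsMaximal] {J : Ideal R}
    (hJ : 𝔪 ≤ J.comap (algebraMap S R)) {V : Type*} [AddCommGroup V] [Module S V]
    (x : R ⊗[S] V) :
    ∃ (d : ℕ) (b : Fin d → R) (v : Fin d → V), x - ∑ j, b j ⊗ₜ v j ∈ J • (⊤ : Submodule R _) ∧
      ∀ w : Fin d → S, ∑ j, w j • b j ∈ J → ∀ j, w j ∈ 𝔪 := by
  obtain ⟨s, rfl⟩ := TensorProduct.exists_finset x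
  obtain ⟨d, b, u, hu, hb⟩ := exists_sum_smul_mem_of_isMaximal hJ fun i : s => i.1.1
  refine ⟨d, b, fun j => ∑ i, u i j • i.1.2, ?_, hb⟩
  have hsum : ∑ i ∈ s, i.1 ⊗ₜ[S] i.2 - ∑ j, b j ⊗ₜ[S] ∑ i, u i j • i.1.2 =
      ∑ i : s, (i.1.1 - ∑ j, u i j • b j) • (1 : R) ⊗ₜ[S] i.1.2 := by
    rw [← Finset.sum_coe_sort s]
    simp only [TensorProduct.tmul_sum, TensorProduct.smul_tmul', smul_eq_mul, mul_one,
      TensorProduct.sub_tmul, TensorProduct.sum_tmul, TensorProduct.tmul_smul,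
      Finset.sum_sub_distrib]
    rw [Finset.sum_comm]
  rw [hsum]
  exact sum_mem fun i _ => Submodule.smul_mem_smul (hu i) Submodule.mem_top

theorem mem_smul_top_of_sum_tmul_mem {𝔪 : Ideal S} {J : Ideal R} {n d : ℕ} {b : Fin d → R}
    (hb : ∀ w : Fin d → S, ∑ j, w j • b j ∈ J → ∀ j, w j ∈ 𝔪) {v : Fin d → Fin n → S}
    (hv : ∑ j, b j ⊗ₜ[S] v j ∈ J • (⊤ : Submodule R (R ⊗[S] (Fin n → S)))) (j : Fin d) :
    ∀ l, v j l ∈ 𝔪 := by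
  intro l
  let coord : R ⊗[S] (Fin n → S) →ₗ[R] R :=
    (TensorProduct.AlgebraTensorModule.rid S R R).toLinearMap ∘ₗ
      (LinearMap.proj l : (Fin n → S) →ₗ[S] S).baseChange R
  have hcoord : coord (∑ j, b j ⊗ₜ[S] v j) ∈ J • (⊤ : Submodule R R) :=
    Submodule.smul_top_le_comap_smul_top J coord hv
  refine hb (fun j => v j l) ?_ j
  simpa [coord] using hcoord

variable {G X : Type*} [Group G] [AddCommGroup X] [Module R X] {ρ : Representation R G X}

/- Modulo `π`, the action on a realisation has coefficients in the field `S ⧸ (π)`. Decomposing a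
vector of `X / J X` along elements of `R ⧸ J` linearly independent over that field, it is
invariant if and only if each of its components is, and the components lift. -/
theorem IsRealisableOver.invariantsMod_le_sup (hρ : IsRealisableOver S ρ) {π : S}
    (hπ : (Ideal.span {π}).IsMaximal) {J : Ideal R} (hJ : algebraMap S R π ∈ J) :
    invariantsMod ρ (J • ⊤) ≤ invariantsMod ρ (Ideal.span {algebraMap S R π} • ⊤) ⊔ J • ⊤ := by
  obtain ⟨n, ρ₀, e, he⟩ := hρ
  intro x hx
  obtain ⟨d, b, v, hxv, hb⟩ := exists_sum_tmul_sub_mem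
    (show Ideal.span {π} ≤ J.comap (algebraMap S R) by rwa [Ideal.span_singleton_le_iff_mem])
    (e.symm x)
  set x' : X := e (∑ j, b j ⊗ₜ v j) with hx'
  have hxx' : x - x' ∈ J • (⊤ : Submodule R X) := by
    simpa [hx'] using Submodule.smul_top_le_comap_smul_top J e.toLinearMap hxv
  refine Submodule.mem_sup.2 ⟨x', ?_, x - x', hxx', add_sub_cancel _ _⟩
  refine mem_invariantsMod.2 fun g => mem_span_singleton_smul_top.2 ?_
  have hρx' : ρ g x' - x' = e (∑ j, b j ⊗ₜ (ρ₀ g (v j) - v j)) := by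
    simp only [hx', map_sum, ← he, TensorProduct.tmul_sub, map_sub, Finset.sum_sub_distrib]
  have hmod : ρ g x' - x' ∈ J • (⊤ : Submodule R X) := by
    have hdiff := sub_mem (mem_invariantsMod.1 hx g)
      (sub_mem (Submodule.smul_top_le_comap_smul_top J (ρ g) hxx') hxx')
    rw [map_sub] at hdiff
    convert hdiff using 1
    abel
  have hsymm : ∑ j, b j ⊗ₜ (ρ₀ g (v j) - v j) ∈ J • (⊤ : Submodule R (R ⊗[S] (Fin n → S))) := by
    simpa [hρx'] using Submodule.smul_top_le_comap_smul_top J e.symm.toLinearMap hmod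
  choose w hw using fun j l =>
    Ideal.mem_span_singleton'.1 (mem_smul_top_of_sum_tmul_mem hb hsymm j l)
  refine ⟨e (∑ j, b j ⊗ₜ w j), ?_⟩
  rw [hρx', ← map_smul, Finset.smul_sum]
  refine congrArg e (Finset.sum_congr rfl fun j _ => ?_)
  rw [algebraMap_smul, ← TensorProduct.tmul_smul]
  refine congrArg (b j ⊗ₜ ·) (funext fun l => ?_)
  rw [Pi.smul_apply, smul_eq_mul, mul_comm, hw]

end Realisable

section RealisableCharpoly

open Polynomial

variable {S R : Type*} [CommRing S] [CommRing R] [Algebra S R]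
  {G M : Type*} [Group G] [AddCommGroup M] [Module R M] {ρ : Representation R G M}

theorem IsRealisableOver.exists_monic_aeval_eq_zero [Nontrivial R] (hρ : IsRealisableOver S ρ)
    (g : G) :
    ∃ Q : S[X], Q.Monic ∧ Q.natDegree = Module.finrank R M ∧
      aeval (ρ g) (Q.map (algebraMap S R)) = 0 := by
  have : Nontrivial S := (algebraMap S R).domain_nontrivial
  obtain ⟨n, ρ₀, e, he⟩ := hρ
  have : Module.Free R M := Module.Free.of_equiv e
  have : Module.Finite R M := Module.Finite.equiv e
  have hconj : e.conj ((ρ₀ g).baseChange R) = ρ g := by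
    have hcomm : ∀ z, e ((ρ₀ g).baseChange R z) = ρ g (e z) := fun z => by
      induction z with
      | zero => simp only [map_zero]
      | add z w hz hw => simp only [map_add, hz, hw]
      | tmul a x => exact he g a x
    ext x
    simp only [LinearEquiv.conj_apply_apply, hcomm, LinearEquiv.apply_symm_apply]
  refine ⟨(ρ₀ g).charpoly, LinearMap.charpoly_monic _, ?_, ?_⟩
  · rw [LinearMap.charpoly_natDegree, ← e.finrank_eq, Module.finrank_baseChange]
  · rw [← LinearMap.charpoly_baseChange, ← LinearEquiv.charpoly_conj e, hconj,
      LinearMap.aeval_self_charpoly]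

theorem IsRealisableOver.resRep_twist (hρ : IsRealisableOver S ρ) {I : Subgroup G} {ψ : G →* Rˣ}
    (hψ : ∀ g ∈ I, ψ g = 1) : IsRealisableOver S (resRep (twist ρ ψ) I) := by
  obtain ⟨n, ρ₀, e, he⟩ := hρ
  refine ⟨n, resRep ρ₀ I, e ≪≫ₗ (TensorProduct.rid R M).symm, fun g a x => ?_⟩
  simp [he, charRep, hψ g g.2]

theorem twist_apply_eq_smul_rTensor (ρ : Representation R G M) (ψ : G →* Rˣ) (g : G) :
    twist ρ ψ g = (ψ g : R) • (ρ g).rTensor R := by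
  ext x
  simp [charRep, ← TensorProduct.tmul_smul]

theorem aeval_twist_comp (ρ : Representation R G M) (ψ : G →* Rˣ) (g : G) {P : R[X]}
    (hP : aeval (ρ g) P = 0) :
    aeval (twist ρ ψ g) (P.comp (C (((ψ g)⁻¹ : Rˣ) : R) * X)) = 0 := by
  have hscale : aeval (twist ρ ψ g) (C (((ψ g)⁻¹ : Rˣ) : R) * X) =
      Module.End.rTensorAlgHom R M R (ρ g) := by
    rw [twist_apply_eq_smul_rTensor, ← smul_eq_C_mul, map_smul, aeval_X, smul_smul,
      Units.inv_mul, one_smul]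
    rfl
  rw [aeval_comp, hscale, aeval_algHom_apply, hP, map_zero]

end RealisableCharpoly

section ValuationRing

variable {R : Type*} [CommRing R] [IsDomain R] [ValuationRing R]

theorem exists_eq_mul_of_not_dvd {a c : R} (h : ¬ a ∣ c) :
    ∃ m ∈ IsLocalRing.maximalIdeal R, a = c * m := by
  obtain ⟨m, rfl⟩ := (ValuationRing.dvd_total c a).resolve_right h
  exact ⟨m, fun hm => h (hm.mul_right_dvd.2 dvd_rfl), rfl⟩

theorem maximalIdeal_eq_span_of_irreducible {π : R} (hπ : Irreducible π) :
    IsLocalRing.maximalIdeal R = Ideal.span {π} := by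
  refine le_antisymm (fun x hx => ?_) (IsLocalRing.le_maximalIdeal
    (by rw [Ne, Ideal.span_singleton_eq_top]; exact hπ.not_isUnit))
  rw [Ideal.mem_span_singleton]
  by_contra hdvd
  obtain ⟨m, hm, e⟩ := exists_eq_mul_of_not_dvd hdvd
  exact (hπ.isUnit_or_isUnit e).elim hx hm

end ValuationRing

section CharpolyDivisibility

open Polynomial

variable {S R : Type*} [CommRing S] [CommRing R] [Algebra S R] [IsLocalRing S] [IsLocalRing R]

theorem dvd_pow_add_natDegree_of_dvd_pow_mul_aeval {π : S}
    (hπ : IsLocalRing.maximalIdeal S = Ideal.span {π}) {Q : S[X]} (hQ : Q.Monic) {μ : R}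
    (hμ : μ ∈ IsLocalRing.maximalIdeal R) {j : ℕ}
    (hdvd : algebraMap S R π ∣ μ ^ j * aeval μ Q) :
    algebraMap S R π ∣ μ ^ (j + Q.natDegree) := by
  have hdec : aeval μ Q = μ * aeval μ Q.divX + algebraMap S R (Q.coeff 0) := by
    conv_lhs => rw [← Q.divX_mul_X_add]
    simp only [map_add, map_mul, aeval_X, aeval_C, mul_comm]
  obtain hdeg | hdeg := Nat.eq_zero_or_pos Q.natDegree
  · simpa [hQ.natDegree_eq_zero.1 hdeg] using hdvd
  by_cases hcoeff : Q.coeff 0 ∈ IsLocalRing.maximalIdeal S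
  · obtain ⟨s, hs⟩ := Ideal.mem_span_singleton'.1 (hπ ▸ hcoeff)
    have hdivX : algebraMap S R π ∣ μ ^ (j + 1) * aeval μ Q.divX := by
      rw [hdec, mul_add, ← hs, map_mul, ← mul_assoc, ← pow_succ] at hdvd
      exact (dvd_add_left ((dvd_mul_left _ _).mul_left _)).1 hdvd
    have hmonic : Q.divX.Monic := by
      rw [Monic, leadingCoeff, natDegree_divX_eq_natDegree_tsub_one, coeff_divX,
        Nat.sub_add_cancel hdeg]
      exact hQ
    have ih := dvd_pow_add_natDegree_of_dvd_pow_mul_aeval hπ hmonic hμ hdivX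
    rwa [natDegree_divX_eq_natDegree_tsub_one, add_assoc, Nat.add_sub_cancel' hdeg] at ih
  · have hunit : IsUnit (aeval μ Q) := by
      by_contra hnonunit
      have hmem : algebraMap S R (Q.coeff 0) ∈ IsLocalRing.maximalIdeal R := by
        rw [← sub_eq_of_eq_add' hdec]
        exact sub_mem hnonunit (Ideal.mul_mem_right _ _ hμ)
      exact hmem ((not_not.1 hcoeff).map (algebraMap S R))
    exact ((hunit.dvd_mul_right).1 hdvd).trans (pow_dvd_pow μ (Nat.le_add_right _ _))
termination_by Q.natDegree
decreasing_by
  rw [natDegree_divX_eq_natDegree_tsub_one]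
  omega

theorem dvd_sub_one_pow_natDegree_of_dvd_aeval {π : S}
    (hπ : IsLocalRing.maximalIdeal S = Ideal.span {π}) {Q : S[X]} (hQ : Q.Monic) {u : R}
    (hu : u - 1 ∈ IsLocalRing.maximalIdeal R) (hdvd : algebraMap S R π ∣ aeval u Q) :
    algebraMap S R π ∣ (u - 1) ^ Q.natDegree := by
  have hshift : aeval (u - 1) (taylor 1 Q) = aeval u Q := by simp [taylor_apply, aeval_comp]
  simpa only [zero_add, natDegree_taylor] using
    dvd_pow_add_natDegree_of_dvd_pow_mul_aeval (j := 0) hπ ((leadingCoeff_taylor 1 Q).trans hQ) hu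
      (by rwa [pow_zero, one_mul, hshift])

end CharpolyDivisibility

section TwistPolynomial

open Polynomial

theorem IsRealisableOver.exists_aeval_twist_eq_zero_eval_one_mul_eq {S R G M : Type*} [CommRing S]
    [IsLocalRing S] [CommRing R] [IsDomain R] [ValuationRing R] [Algebra S R] [Group G]
    [AddCommGroup M] [Module R M] {ρ : Representation R G M} (hρ : IsRealisableOver S ρ) {π : S}
    (hπ : IsLocalRing.maximalIdeal S = Ideal.span {π}) {ψ : G →* Rˣ} {g : G}
    (hψ : (ψ g : R) - 1 ∈ IsLocalRing.maximalIdeal R)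
    (hndvd : ¬ algebraMap S R π ∣ ((ψ g : R) - 1) ^ Module.finrank R M) :
    ∃ P : R[X], aeval (twist ρ ψ g) P = 0 ∧
      ∃ m ∈ IsLocalRing.maximalIdeal R, P.eval 1 * m = algebraMap S R π := by
  obtain ⟨Q, hQ, hdeg, hQρ⟩ := hρ.exists_monic_aeval_eq_zero g
  have hinv : (((ψ g)⁻¹ : Rˣ) : R) - 1 = -((ψ g)⁻¹ : Rˣ) * ((ψ g : R) - 1) := by
    linear_combination (ψ g).inv_mul
  have hinv' : (ψ g : R) - 1 = -(ψ g : R) * ((((ψ g)⁻¹ : Rˣ) : R) - 1) := by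
    linear_combination (ψ g).mul_inv
  have hmem : (((ψ g)⁻¹ : Rˣ) : R) - 1 ∈ IsLocalRing.maximalIdeal R :=
    hinv ▸ Ideal.mul_mem_left _ _ hψ
  have hQndvd : ¬ algebraMap S R π ∣ aeval (((ψ g)⁻¹ : Rˣ) : R) Q := fun h => hndvd <| by
    rw [hinv', mul_pow, ← hdeg]
    exact (dvd_sub_one_pow_natDegree_of_dvd_aeval hπ hQ hmem h).mul_left _
  obtain ⟨m, hm, hϖ⟩ := exists_eq_mul_of_not_dvd hQndvd
  refine ⟨_, aeval_twist_comp ρ ψ g hQρ, m, hm, ?_⟩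
  rw [hϖ, eval_comp, eval_map_algebraMap, eval_mul, eval_C, eval_X, mul_one]

end TwistPolynomial

/-! ### Rings of integers -/

section Integers

variable {p : ℕ} [Fact p.Prime] {L : Type*} [Field L] [Algebra ℚ_[p] L]
  [Algebra.IsAlgebraic ℚ_[p] L]

theorem spectralNorm_padic_mul (x y : L) :
    spectralNorm ℚ_[p] L (x * y) = spectralNorm ℚ_[p] L x * spectralNorm ℚ_[p] L y := by
  simpa only [spectralMulAlgNorm_def] using map_mul (spectralMulAlgNorm ℚ_[p] L) x y

theorem spectralNorm_padic_pow (x : L) (n : ℕ) :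
    spectralNorm ℚ_[p] L (x ^ n) = spectralNorm ℚ_[p] L x ^ n := by
  simpa only [spectralMulAlgNorm_def] using map_pow (spectralMulAlgNorm ℚ_[p] L) x n

theorem dvd_integers_iff {a b : integers p L} (ha : a ≠ 0) :
    a ∣ b ↔ spectralNorm ℚ_[p] L (b : L) ≤ spectralNorm ℚ_[p] L (a : L) := by
  have ha' : (a : L) ≠ 0 := fun h => ha (Subtype.ext h)
  have hpos : 0 < spectralNorm ℚ_[p] L (a : L) :=
    spectralNorm_zero_lt ha' (Algebra.IsAlgebraic.isAlgebraic _)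
  have hb : (b : L) = a * (b / a) := (mul_div_cancel₀ _ ha').symm
  constructor
  · rintro ⟨c, rfl⟩
    exact (spectralNorm_padic_mul (a : L) c).trans_le
      (mul_le_of_le_one_right (spectralNorm_nonneg _) c.2)
  · intro h
    rw [hb, spectralNorm_padic_mul, mul_le_iff_le_one_right hpos] at h
    exact ⟨⟨_, h⟩, Subtype.ext hb⟩

theorem mem_maximalIdeal_integers_iff {x : integers p L} :
    x ∈ IsLocalRing.maximalIdeal (integers p L) ↔ spectralNorm ℚ_[p] L (x : L) < 1 := by
  by_cases hx : x = 0
  · simp [hx, spectralNorm_zero]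
  rw [IsLocalRing.mem_maximalIdeal, mem_nonunits_iff, isUnit_iff_dvd_one, dvd_integers_iff hx,
    ← not_le]
  simp [spectralNorm_one]

theorem algebraMap_mem_maximalIdeal_integers {F : Type*} [Field F] [Algebra ℚ_[p] F]
    [Algebra.IsAlgebraic ℚ_[p] F] {E : IntermediateField ℚ_[p] F} {x : integers p E}
    (hx : x ∈ IsLocalRing.maximalIdeal (integers p E)) :
    algebraMap (integers p E) (integers p F) x ∈ IsLocalRing.maximalIdeal (integers p F) := by
  rw [mem_maximalIdeal_integers_iff] at hx ⊢
  rwa [spectralNorm.eq_of_tower (K := ℚ_[p]) (E := E) (L := F)] at hx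

theorem residue_integers_eq_iff {x y : integers p L} :
    IsLocalRing.residue (integers p L) x = IsLocalRing.residue (integers p L) y ↔
      spectralNorm ℚ_[p] L ((x : L) - y) < 1 := by
  rw [← sub_eq_zero, ← map_sub, IsLocalRing.residue_eq_zero_iff, mem_maximalIdeal_integers_iff]
  rfl

theorem mem_maximalIdeal_of_normalizedVal_pos {π u : integers p L}
    (hπ : π ∈ IsLocalRing.maximalIdeal (integers p L))
    (hv : 0 < normalizedVal p (π : L) (u : L)) :
    u ∈ IsLocalRing.maximalIdeal (integers p L) := by
  rw [mem_maximalIdeal_integers_iff] at hπ ⊢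
  have hlogπ : Real.log (spectralNorm ℚ_[p] L (π : L)) ≤ 0 :=
    Real.log_nonpos (spectralNorm_nonneg _) hπ.le
  by_contra! h
  exact hv.not_ge (div_nonpos_of_nonneg_of_nonpos (Real.log_nonneg h) hlogπ)

theorem not_dvd_pow_of_mul_normalizedVal_lt_one {π u : integers p L} (hπ0 : π ≠ 0)
    (hπ : π ∈ IsLocalRing.maximalIdeal (integers p L)) (hu : u ≠ 0) {n : ℕ}
    (hv : n * normalizedVal p (π : L) (u : L) < 1) : ¬ π ∣ u ^ n := by
  have hpos : ∀ x : integers p L, x ≠ 0 → 0 < spectralNorm ℚ_[p] L (x : L) := fun x hx =>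
    spectralNorm_zero_lt (fun h => hx (Subtype.ext h)) (Algebra.IsAlgebraic.isAlgebraic _)
  have hlogπ := Real.log_neg (hpos π hπ0) (mem_maximalIdeal_integers_iff.1 hπ)
  rw [normalizedVal, ← mul_div_assoc, div_lt_one_of_neg hlogπ, ← Real.log_pow,
    Real.log_lt_log_iff (hpos π hπ0) (pow_pos (hpos u hu) n), ← spectralNorm_padic_pow] at hv
  rw [dvd_integers_iff hπ0, not_le]
  exact hv

end Integers

/-! ### Inertia and Frobenius generate the Galois group topologically -/

section Density

variable {G Q : Type*} [Group G] [TopologicalSpace G] [IsTopologicalGroup G] [CompactSpace G]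
  [Group Q] [TopologicalSpace Q] [T2Space Q]

theorem dense_ker_sup_zpowers {f : G →* Q} (hf : Continuous f) {g : G}
    (hg : Dense (Subgroup.zpowers (f g) : Set Q)) :
    Dense ((f.ker ⊔ Subgroup.zpowers g : Subgroup G) : Set G) := by
  set H := (f.ker ⊔ Subgroup.zpowers g).topologicalClosure with hH
  have hclosed : IsClosed (f '' H) :=
    hf.isClosedMap _ (Subgroup.isClosed_topologicalClosure _)
  have hsurj : ∀ q, q ∈ f '' H := by
    have hsub : (Subgroup.zpowers (f g) : Set Q) ⊆ f '' H := by
      rintro _ ⟨n, rfl⟩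
      exact ⟨g ^ n, Subgroup.le_topologicalClosure _
        (Subgroup.mem_sup_right (Subgroup.zpow_mem_zpowers g n)), map_zpow f g n⟩
    exact fun q => hclosed.closure_subset_iff.2 hsub (hg q)
  intro σ
  obtain ⟨h, hh, e⟩ := hsurj (f σ)
  have hker : h⁻¹ * σ ∈ H := Subgroup.le_topologicalClosure _ <| Subgroup.mem_sup_left <| by
    rw [MonoidHom.mem_ker, map_mul, map_inv, e, inv_mul_cancel]
  rw [← Subgroup.topologicalClosure_coe, ← hH, ← mul_inv_cancel_left h σ]
  exact H.mul_mem hh hker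

end Density

section GaloisGroups

variable {k κ : Type*} [Field k] [Field κ] [Algebra k κ]

theorem continuous_of_eventually_apply_eq {G : Type*} [Group G]
    [TopologicalSpace G] [IsTopologicalGroup G] {f : G →* Gal(κ/k)}
    (hf : ∀ x, ∀ᶠ g in nhds 1, f g x = x) : Continuous f := by
  refine continuous_of_continuousAt_one f fun s hs => ?_
  rw [map_one] at hs
  obtain ⟨E, _, hE⟩ := (krullTopology_mem_nhds_one_iff k κ s).1 hs
  let b := Module.finBasis k E
  rw [Filter.mem_map]
  filter_upwards [Filter.eventually_all.2 fun i => hf (b i)] with g (hg : ∀ i, f g (b i) = b i)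
  refine hE ((IntermediateField.mem_fixingSubgroup_iff _ _).2 fun x hx => ?_)
  exact LinearMap.congr_fun
    (b.ext hg : (f g).toLinearMap ∘ₗ E.val.toLinearMap = E.val.toLinearMap) ⟨x, hx⟩

theorem dense_zpowers_of_forall_apply_eq_pow_card [Finite k] [Algebra.IsAlgebraic k κ]
    {φ : Gal(κ/k)} (hφ : ∀ x, φ x = x ^ Nat.card k) :
    Dense (Subgroup.zpowers φ : Set Gal(κ/k)) := by
  have hpow : ∀ (n : ℕ) x, (φ ^ n) x = x ^ Nat.card k ^ n := fun n => by
    induction n with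
    | zero => simp
    | succ n ih => intro x; rw [pow_succ, AlgEquiv.mul_apply, hφ, ih, ← pow_mul, pow_succ']
  intro σ
  rw [mem_closure_iff_nhds_one]
  intro s hs
  obtain ⟨E, _, hE⟩ := (krullTopology_mem_nhds_one_iff k κ s).1 hs
  have : Finite E := Module.finite_of_finite k
  obtain ⟨q, _⟩ := CharP.exists k
  have : Fact q.Prime := ⟨CharP.char_is_prime k q⟩
  obtain ⟨n, hn⟩ := FiniteField.exists_forall_apply_eq_pow k q E (σ⁻¹.restrictNormal E)
  refine ⟨(φ ^ n)⁻¹, inv_mem (Subgroup.npow_mem_zpowers φ n), hE ?_⟩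
  rw [SetLike.mem_coe, IntermediateField.mem_fixingSubgroup_iff]
  intro x hx
  have hσ := congrArg (algebraMap E κ) (hn ⟨x, hx⟩)
  rw [AlgEquiv.restrictNormal_commutes, map_pow] at hσ
  change (φ ^ n)⁻¹ (σ⁻¹ x) = x
  rw [show σ⁻¹ x = (φ ^ n) x from hσ.trans (hpow n x).symm]
  exact (φ ^ n).symm_apply_apply x

end GaloisGroups

section ResidueAction

variable (p : ℕ) [Fact p.Prime] (K : Type*) [Field K] [Algebra ℚ_[p] K]
  [Algebra.IsAlgebraic ℚ_[p] K]

attribute [local instance] isAlgebraic_algebraicClosure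

instance : MulSemiringAction (absGal K) (integers p (AlgebraicClosure K)) where
  smul σ x := ⟨σ x, (spectralNorm_absGal p K σ x).trans_le x.2⟩
  one_smul _ := rfl
  mul_smul _ _ _ := rfl
  smul_zero σ := Subtype.ext (map_zero σ)
  smul_add σ x y := Subtype.ext (map_add σ (x : AlgebraicClosure K) y)
  smul_one σ := Subtype.ext (map_one σ)
  smul_mul σ x y := Subtype.ext (map_mul σ (x : AlgebraicClosure K) y)

instance : Algebra (integers p K) (integers p (AlgebraicClosure K)) :=
  (((algebraMap K (AlgebraicClosure K)).comp (integers p K).subtype).codRestrict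
    (integers p (AlgebraicClosure K)) fun x =>
      (spectralNorm.eq_of_tower (K := ℚ_[p]) (x : K)).symm.trans_le x.2).toAlgebra

instance : IsLocalHom (algebraMap (integers p K) (integers p (AlgebraicClosure K))) where
  map_nonunit x := by
    contrapose
    exact fun hx => (mem_maximalIdeal_integers_iff (p := p)).2
      ((spectralNorm.eq_of_tower (K := ℚ_[p]) (L := AlgebraicClosure K) (x : K)).symm.trans_lt
        ((mem_maximalIdeal_integers_iff (p := p)).1 hx))

instance : SMulCommClass (absGal K) (resField p K) (resField p (AlgebraicClosure K)) := by
  refine ⟨fun σ a y => ?_⟩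
  obtain ⟨a, rfl⟩ := IsLocalRing.residue_surjective a
  rw [Algebra.smul_def, Algebra.smul_def, smul_mul', IsLocalRing.ResidueField.algebraMap_residue,
    ← IsLocalRing.ResidueField.residue_smul]
  congr 2
  exact Subtype.ext (σ.commutes (a : K))

instance : Algebra.IsIntegral (integers p K) (integers p (AlgebraicClosure K)) := by
  refine ⟨fun x => ?_⟩
  have hm := minpoly.monic (Algebra.IsIntegral.isIntegral (R := ℚ_[p]) (x : AlgebraicClosure K))
  have hcoeff := (spectralValue_le_one_iff hm).1 x.2
  have hlifts : (minpoly ℚ_[p] (x : AlgebraicClosure K)).map (algebraMap ℚ_[p] K) ∈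
      Polynomial.lifts (integers p K).subtype := by
    refine (Polynomial.lifts_iff_coeff_lifts _).2 fun n => ?_
    rw [Polynomial.coeff_map]
    exact ⟨⟨_, (spectralNorm_extends _).trans_le (hcoeff n)⟩, rfl⟩
  obtain ⟨P, hP, -, hPm⟩ := Polynomial.lifts_and_natDegree_eq_and_monic hlifts (hm.map _)
  refine ⟨P, hPm, Subtype.ext ?_⟩
  refine (Polynomial.hom_eval₂ P _ (integers p (AlgebraicClosure K)).subtype x).trans ?_
  change Polynomial.eval₂ ((algebraMap K (AlgebraicClosure K)).comp (integers p K).subtype)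
    (x : AlgebraicClosure K) P = 0
  rw [← Polynomial.eval₂_map, hP, Polynomial.eval₂_map, ← IsScalarTower.algebraMap_eq]
  exact minpoly.aeval ℚ_[p] _

instance : Algebra.IsAlgebraic (resField p K) (resField p (AlgebraicClosure K)) := by
  rw [Algebra.isAlgebraic_iff_isIntegral]
  refine ⟨fun y => ?_⟩
  obtain ⟨y, rfl⟩ := IsLocalRing.residue_surjective y
  exact ((Algebra.IsIntegral.isIntegral (R := integers p K) y).map
    (IsScalarTower.toAlgHom (integers p K) (integers p (AlgebraicClosure K))
      (resField p (AlgebraicClosure K)))).tower_top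

/-- The action of `G_K` on the residue field of the algebraic closure of `K`. -/
def residueGalHom : absGal K →* Gal(resField p (AlgebraicClosure K)/resField p K) :=
  MulSemiringAction.toAlgAut _ _ _

variable {p K}

theorem residueGalHom_residue (σ : absGal K) (x : integers p (AlgebraicClosure K)) :
    residueGalHom p K σ (IsLocalRing.residue _ x) = IsLocalRing.residue _ (σ • x) :=
  (IsLocalRing.ResidueField.residue_smul _ σ x).symm

theorem continuous_residueGalHom : Continuous (residueGalHom p K) := by
  refine continuous_of_eventually_apply_eq fun y => ?_
  obtain ⟨x, rfl⟩ := IsLocalRing.residue_surjective y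
  filter_upwards [(stabilizer_isOpen_of_isIntegral (x : AlgebraicClosure K)).mem_nhds
    (one_mem (MulAction.stabilizer (absGal K) (x : AlgebraicClosure K)))] with σ hσ
  rw [residueGalHom_residue]
  exact congrArg _ (Subtype.ext hσ)

theorem ker_residueGalHom : (residueGalHom p K).ker = inertia p K := by
  ext σ
  rw [MonoidHom.mem_ker, AlgEquiv.ext_iff, IsLocalRing.residue_surjective.forall]
  simp only [residueGalHom_residue, AlgEquiv.one_apply, residue_integers_eq_iff]
  exact Subtype.forall

theorem IsGeomFrob.residueGalHom_inv_apply {Φ : absGal K} (hΦ : IsGeomFrob p K Φ)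
    (y : resField p (AlgebraicClosure K)) :
    residueGalHom p K Φ⁻¹ y = y ^ Nat.card (resField p K) := by
  obtain ⟨x, rfl⟩ := IsLocalRing.residue_surjective y
  rw [residueGalHom_residue, ← map_pow, residue_integers_eq_iff]
  exact hΦ x x.2

theorem IsGeomFrob.finite_resField {Φ : absGal K} (hΦ : IsGeomFrob p K Φ) :
    Finite (resField p K) := by
  refine Nat.finite_of_card_ne_zero fun h => ?_
  have h0 := hΦ.residueGalHom_inv_apply 0
  rw [h, pow_zero, map_zero] at h0
  exact zero_ne_one h0

instance inertia_normal : (inertia p K).Normal :=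
  ker_residueGalHom (p := p) (K := K) ▸ inferInstance

theorem IsGeomFrob.dense_inertia_sup_zpowers {Φ : absGal K} (hΦ : IsGeomFrob p K Φ) :
    Dense ((inertia p K ⊔ Subgroup.zpowers Φ : Subgroup (absGal K)) : Set (absGal K)) := by
  have : CharZero K := charZero_of_injective_algebraMap (algebraMap ℚ_[p] K).injective
  have := hΦ.finite_resField
  rw [← ker_residueGalHom, ← Subgroup.zpowers_inv]
  exact dense_ker_sup_zpowers continuous_residueGalHom
    (dense_zpowers_of_forall_apply_eq_pow_card hΦ.residueGalHom_inv_apply)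

end ResidueAction

/-! ### Small unramified twists -/

section Reduction

theorem bijective_smul_tmul_of_isUnit {R A B : Type*} [CommRing R] [AddCommGroup A] [Module R A]
    [CommRing B] [Algebra R B] {c : R} (hc : IsUnit (algebraMap R B c)) :
    Function.Bijective fun b : A ⊗[R] B => c • b := by
  have h := (hc.map (Algebra.lmul R B)).map (Module.End.lTensorAlgHom R B A)
  rw [AlgHom.commutes, AlgHom.commutes] at h
  exact (Module.End.isUnit_iff _).1 h

theorem ker_lTensor_of_surjective {R M N : Type*} [CommRing R] [AddCommGroup M] [Module R M]
    [AddCommGroup N] [Module R N] (f : R →ₗ[R] N) (hf : Function.Surjective f) :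
    LinearMap.ker (f.lTensor M) = LinearMap.ker f • (⊤ : Submodule R (M ⊗[R] R)) := by
  refine le_antisymm ?_ (Submodule.smul_le.2 fun r hr z _ => ?_)
  · rw [(lTensor_exact M f.exact_subtype_ker_map hf).linearMap_ker_eq]
    rintro _ ⟨z, rfl⟩
    induction z with
    | zero => simp only [map_zero, zero_mem]
    | add y z hy hz => simpa only [map_add] using add_mem hy hz
    | tmul x r =>
      have e : x ⊗ₜ[R] (r : R) = (r : R) • x ⊗ₜ[R] (1 : R) := by
        rw [← TensorProduct.tmul_smul, smul_eq_mul, mul_one]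
      rw [LinearMap.lTensor_tmul, Submodule.subtype_apply, e]
      exact Submodule.smul_mem_smul r.2 trivial
  · rw [LinearMap.mem_ker] at hr ⊢
    induction z with
    | zero => simp only [smul_zero, map_zero]
    | add y z hy hz => rw [smul_add, map_add, hy trivial, hz trivial, add_zero]
    | tmul x s =>
      rw [← TensorProduct.tmul_smul, LinearMap.lTensor_tmul, smul_eq_mul, mul_comm,
        ← smul_eq_mul, map_smul, hr, smul_zero, TensorProduct.tmul_zero]

variable {p : ℕ} [Fact p.Prime] {F : Type*} [Field F] [Algebra ℚ_[p] F]
  [FiniteDimensional ℚ_[p] F]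

theorem natCast_prime_mem_maximalIdeal :
    (p : integers p F) ∈ IsLocalRing.maximalIdeal (integers p F) :=
  (IsLocalRing.residue_eq_zero_iff _).1 natCast_prime_resField

theorem bijective_smul_tmul_field {A : Type*} [AddCommGroup A] [Module (integers p F) A]
    {c : integers p F} (hc : c ≠ 0) :
    Function.Bijective fun b : A ⊗[integers p F] F => c • b :=
  bijective_smul_tmul_of_isUnit (IsUnit.mk0 _ fun h => hc (Subtype.ext h))

theorem natCast_prime_ne_zero : (p : integers p F) ≠ 0 := by
  have : CharZero F := charZero_of_injective_algebraMap (algebraMap ℚ_[p] F).injective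
  exact fun h => (Fact.out : p.Prime).ne_zero
    (Nat.cast_eq_zero (R := F) |>.1 (congrArg Subtype.val h))

theorem exists_pow_smul_FmodO_eq_zero (x : FmodO p F) : ∃ n, (p : integers p F) ^ n • x = 0 := by
  obtain ⟨f, rfl⟩ := Submodule.mkQ_surjective _ x
  obtain ⟨n, a, ha⟩ := exists_pow_smul p f
  refine ⟨n, ?_⟩
  rw [← map_smul, Submodule.mkQ_apply, Submodule.Quotient.mk_eq_zero]
  exact ⟨a, by rw [Algebra.linearMap_apply, Algebra.smul_def, map_pow, map_natCast, ha]; rfl⟩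

theorem pow_smul_resField_eq_zero (x : resField p F) : (p : integers p F) ^ 1 • x = 0 := by
  rw [pow_one, Algebra.smul_def, natCast_prime_resField, zero_mul]

variable {X : Type*} [AddCommGroup X] [Module (integers p F) X]

theorem ker_reduction : LinearMap.ker (reduction p X) =
    IsLocalRing.maximalIdeal (integers p F) •
      (⊤ : Submodule (integers p F) (X ⊗[integers p F] (integers p F))) := by
  have hker : LinearMap.ker (Algebra.linearMap (integers p F) (resField p F)) =
      IsLocalRing.maximalIdeal (integers p F) :=
    Ideal.ext fun x => IsLocalRing.residue_eq_zero_iff x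
  rw [← hker]
  exact ker_lTensor_of_surjective _ IsLocalRing.residue_surjective

theorem reduction_surjective : Function.Surjective (reduction p (F := F) X) :=
  LinearMap.lTensor_surjective _ IsLocalRing.residue_surjective

end Reduction

section DeltaDual

variable {p : ℕ} [Fact p.Prime] {K : Type*} [Field K] [Algebra ℚ_[p] K]
  [Algebra.IsAlgebraic ℚ_[p] K] {F : Type*} [Field F] [Algebra ℚ_[p] F]
  [FiniteDimensional ℚ_[p] F] {X : Type*} [AddCommGroup X] [Module (integers p F) X]
  {Φ : absGal K} {ρ : Representation (integers p F) (absGal K) X}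
  {ψ : absGal K →* (integers p F)ˣ}

/-- The hypotheses on the unramified character `ψ` by which `ρ` is twisted: the lattice is
realisable over the integers of a subfield `E` with uniformiser `ϖ`, and
`0 < v_E(ψ(Φ) - 1) < 1 / rank X`. The upper bound is written without division, so it is no
condition on the valuation when `X = 0`. -/
structure IsSmallUnramifiedTwist (Φ : absGal K)
    (ρ : Representation (integers p F) (absGal K) X) (ψ : absGal K →* (integers p F)ˣ) : Prop where
  eq_one_of_mem_inertia : ∀ g ∈ inertia p K, ψ g = 1
  exists_realisable : ∃ (E : IntermediateField ℚ_[p] F) (ϖ : integers p E), Irreducible ϖ ∧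
    IsRealisableOver (integers p E) ρ ∧
    0 < normalizedVal p ((ϖ : E) : F) (((ψ Φ : integers p F) : F) - 1) ∧
    Module.finrank (integers p F) X *
      normalizedVal p ((ϖ : E) : F) (((ψ Φ : integers p F) : F) - 1) < 1

namespace IsSmallUnramifiedTwist

theorem sub_one_mem_maximalIdeal (h : IsSmallUnramifiedTwist Φ ρ ψ) :
    (ψ Φ : integers p F) - 1 ∈ IsLocalRing.maximalIdeal (integers p F) := by
  obtain ⟨E, ϖ, hϖ, -, hpos, -⟩ := h.exists_realisable
  exact mem_maximalIdeal_of_normalizedVal_pos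
    (algebraMap_mem_maximalIdeal_integers hϖ.not_isUnit) hpos

theorem residue_eq_one (h : IsSmallUnramifiedTwist Φ ρ ψ) (hΦ : IsGeomFrob p K Φ)
    (hψ : IsContRep p (charRep ψ)) (g : absGal K) :
    IsLocalRing.residue (integers p F) (ψ g) = 1 := by
  let χ : Representation (resField p F) (absGal K) (resField p F) :=
    charRep ((Units.map (IsLocalRing.residue (integers p F)).toMonoidHom).comp ψ)
  have hχ : ∀ g, χ g 1 = IsLocalRing.residue (integers p F) (ψ g) := fun g => mul_one _
  have hcont : IsLocallyConstant fun g => χ g 1 :=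
    (IsLocallyConstant.iff_eventually_eq _).2 fun g₀ => by
      filter_upwards [hψ.eventually 1 1 g₀] with g ⟨y, hy⟩
      have hsub : (ψ g : integers p F) - ψ g₀ = p * y := by simpa [charRep] using hy
      rw [hχ, hχ, ← sub_eq_zero, ← map_sub, IsLocalRing.residue_eq_zero_iff, hsub]
      exact Ideal.mul_mem_right _ _ natCast_prime_mem_maximalIdeal
  rw [← hχ]
  refine mem_invariants_of_dense hcont hΦ.dense_inertia_sup_zpowers (fun g hg => ?_) ?_ g
  · rw [hχ, h.eq_one_of_mem_inertia g hg, Units.val_one, map_one]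
  · rw [hχ, ← sub_eq_zero, ← map_one (IsLocalRing.residue (integers p F)), ← map_sub,
      IsLocalRing.residue_eq_zero_iff]
    exact h.sub_one_mem_maximalIdeal

theorem range_deltaDual [Module.Free (integers p F) X] (h : IsSmallUnramifiedTwist Φ ρ ψ)
    (hΦ : IsGeomFrob p K Φ) (hρ : IsContRep p ρ) (hψ : IsContRep p (charRep ψ))
    (hres : ∀ g, IsLocalRing.residue (integers p F) (ψ g) = 1) :
    LinearMap.range (deltaDual hρ hψ hres) = H1ur p (tensorTriv ρ (resField p F)) := by
  obtain ⟨E, ϖ, hϖ, hreal, hpos, hlt⟩ := h.exists_realisable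
  have hmax := maximalIdeal_eq_span_of_irreducible hϖ
  have hϖ0 : algebraMap (integers p E) (integers p F) ϖ ≠ 0 := fun h0 => by
    have h0' : ((ϖ : E) : F) = 0 := congrArg Subtype.val h0
    exact hϖ.ne_zero (Subtype.ext (Subtype.ext h0'))
  have hu0 : (ψ Φ : integers p F) - 1 ≠ 0 := fun h0 => by
    have h0' : ((ψ Φ : integers p F) : F) - 1 = 0 := congrArg Subtype.val h0
    -- `Real.log 0 = 0` gives `normalizedVal` the value `0` at `0`
    simp [h0', normalizedVal, spectralNorm_zero] at hpos
  obtain ⟨P, hP, m, hm, hPm⟩ := hreal.exists_aeval_twist_eq_zero_eval_one_mul_eq hmax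
    h.sub_one_mem_maximalIdeal (not_dvd_pow_of_mul_normalizedVal_lt_one hϖ0
      (algebraMap_mem_maximalIdeal_integers hϖ.not_isUnit) hu0 hlt)
  refine (connectingData hρ hψ hres).range_delta_eq_ker_H1res hΦ.dense_inertia_sup_zpowers hP
    (fun b => ?_) (bijective_smul_tmul_field (left_ne_zero_of_mul (hPm ▸ hϖ0))) hm
    ker_reduction reduction_surjective
    (isLocallyConstant_tensorTriv_apply (twist_eventually hρ hψ) exists_pow_smul_FmodO_eq_zero)
    (isLocallyConstant_tensorTriv_apply hρ.eventually fun x => ⟨1, pow_smul_resField_eq_zero x⟩)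
    fun J hJ => ?_
  · obtain ⟨n, a, ha⟩ := exists_pow_smul_tensor b
    exact ⟨_, (bijective_smul_tmul_field (pow_ne_zero n natCast_prime_ne_zero)).1, a, ha.symm⟩
  · rw [hPm] at hJ ⊢
    exact (hreal.resRep_twist h.eq_one_of_mem_inertia).invariantsMod_le_sup
      (hmax ▸ IsLocalRing.maximalIdeal.isMaximal _) hJ

end IsSmallUnramifiedTwist

end DeltaDual

end GalTwist

open GalTwist in
theorem mainTheorem10_general (p : ℕ) [Fact p.Prime] {K : Type*} [Field K] [Algebra ℚ_[p] K]
    [Algebra.IsAlgebraic ℚ_[p] K] {Φ : absGal K} (hΦ : IsGeomFrob p K Φ)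
    {F : Type*} [Field F] [Algebra ℚ_[p] F] [FiniteDimensional ℚ_[p] F]
    {X : Type*} [AddCommGroup X] [Module (integers p F) X] [Module.Free (integers p F) X]
    {ρ : Representation (integers p F) (absGal K) X} (hρ : IsContRep p ρ)
    {ψ : absGal K →* (integers p F)ˣ} (hψ : IsContRep p (charRep ψ))
    (h : IsSmallUnramifiedTwist Φ ρ ψ) :
    ∃ hres : ∀ g, IsLocalRing.residue (integers p F) (ψ g) = 1,
      LinearMap.range (deltaDual hρ hψ hres) = H1ur p (tensorTriv ρ (resField p F)) ∧
      ∀ (F' : Type*) [Field F'] [Algebra ℚ_[p] F'] [FiniteDimensional ℚ_[p] F']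
        (X' : Type*) [AddCommGroup X'] [Module (integers p F') X']
        [Module.Free (integers p F') X']
        (ρ' : Representation (integers p F') (absGal K) X') (hρ' : IsContRep p ρ')
        (ψ' : absGal K →* (integers p F')ˣ) (hψ' : IsContRep p (charRep ψ'))
        (_ : IsSmallUnramifiedTwist Φ ρ' ψ')
        (hres' : ∀ g, IsLocalRing.residue (integers p F') (ψ' g) = 1)
        (φ : X ⊗[integers p F] resField p F ≃+ X' ⊗[integers p F'] resField p F')
        (hφ : ∀ g m, φ.toAddMonoidHom (tensorTriv ρ (resField p F) g m) =
          tensorTriv ρ' (resField p F') g (φ.toAddMonoidHom m)),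
        (LinearMap.range (deltaDual hρ hψ hres)).toAddSubgroup.map
            (H1map _ _ φ.toAddMonoidHom hφ) =
          (LinearMap.range (deltaDual hρ' hψ' hres')).toAddSubgroup := by
  have hrange := h.range_deltaDual hΦ hρ hψ (h.residue_eq_one hΦ hψ)
  refine ⟨h.residue_eq_one hΦ hψ, hrange, fun F' _ _ _ X' _ _ _ ρ' hρ' ψ' hψ' h' hres' φ hφ => ?_⟩
  rw [hrange, h'.range_deltaDual hΦ hρ' hψ' hres']
  exact map_H1map_ker_H1res φ hφ

end

theorem mainTheorem10 (p : ℕ) [Fact p.Prime]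
    {K : Type*} [Field K] [Algebra ℚ_[p] K] [FiniteDimensional ℚ_[p] K]
    (Frob : GalTwist.absGal K) (hFrob : GalTwist.IsGeomFrob p K Frob)
    -- the coefficient field `F`, the lattice `X` and the unramified character `ψ`
    {F : Type*} [Field F] [Algebra ℚ_[p] F] [FiniteDimensional ℚ_[p] F]
    {X : Type*} [AddCommGroup X] [Module (GalTwist.integers p F) X]
    [Module.Free (GalTwist.integers p F) X] [Module.Finite (GalTwist.integers p F) X]
    (ρ : Representation (GalTwist.integers p F) (GalTwist.absGal K) X)
    (hρ : GalTwist.IsContRep p ρ)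
    (ψ : GalTwist.absGal K →* (GalTwist.integers p F)ˣ)
    (hψ : GalTwist.IsContRep p (GalTwist.charRep ψ))
    (hunr : ∀ g ∈ GalTwist.inertia p K, ψ g = 1)
    -- the subfield `E` with uniformiser `ϖ`
    (E : IntermediateField ℚ_[p] F)
    (hreal : GalTwist.IsRealisableOver (GalTwist.integers p E) ρ)
    (he : Module.finrank (GalTwist.integers p F) X <
      (IsLocalRing.maximalIdeal (GalTwist.integers p F)).ramificationIdx (GalTwist.integers p E))
    (ϖ : GalTwist.integers p E) (hϖ : Irreducible ϖ)
    (hv₀ : 0 < GalTwist.normalizedVal p ((ϖ : E) : F)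
      (((ψ Frob : GalTwist.integers p F) : F) - 1))
    (hv₁ : Module.finrank (GalTwist.integers p F) X * GalTwist.normalizedVal p ((ϖ : E) : F)
      (((ψ Frob : GalTwist.integers p F) : F) - 1) < 1)
    (hinv : (GalTwist.twist ρ ψ).invariants = ⊥) :
    ∃ hres : ∀ g, IsLocalRing.residue (GalTwist.integers p F) (ψ g) = 1,
      LinearMap.range (GalTwist.deltaDual hρ hψ hres) =
        GalTwist.H1ur p (GalTwist.tensorTriv ρ (GalTwist.resField p F)) ∧
      -- the image depends only on the `G_K`-module `X ⊗ 𝔽`: it corresponds to the image for any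
      -- other choice of `F`, `X`, `ψ` as above under any isomorphism of the reductions
      ∀ (F' : Type*) [Field F'] [Algebra ℚ_[p] F'] [FiniteDimensional ℚ_[p] F']
        (X' : Type*) [AddCommGroup X'] [Module (GalTwist.integers p F') X']
        [Module.Free (GalTwist.integers p F') X'] [Module.Finite (GalTwist.integers p F') X']
        (ρ' : Representation (GalTwist.integers p F') (GalTwist.absGal K) X')
        (hρ' : GalTwist.IsContRep p ρ')
        (ψ' : GalTwist.absGal K →* (GalTwist.integers p F')ˣ)
        (hψ' : GalTwist.IsContRep p (GalTwist.charRep ψ'))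
        (_ : ∀ g ∈ GalTwist.inertia p K, ψ' g = 1)
        (E' : IntermediateField ℚ_[p] F')
        (_ : GalTwist.IsRealisableOver (GalTwist.integers p E') ρ')
        (_ : Module.finrank (GalTwist.integers p F') X' <
          (IsLocalRing.maximalIdeal (GalTwist.integers p F')).ramificationIdx
            (GalTwist.integers p E'))
        (ϖ' : GalTwist.integers p E') (_ : Irreducible ϖ')
        (_ : 0 < GalTwist.normalizedVal p ((ϖ' : E') : F')
          (((ψ' Frob : GalTwist.integers p F') : F') - 1))
        (_ : Module.finrank (GalTwist.integers p F') X' *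
          GalTwist.normalizedVal p ((ϖ' : E') : F')
            (((ψ' Frob : GalTwist.integers p F') : F') - 1) < 1)
        (_ : (GalTwist.twist ρ' ψ').invariants = ⊥)
        (hres' : ∀ g, IsLocalRing.residue (GalTwist.integers p F') (ψ' g) = 1)
        (φ : TensorProduct (GalTwist.integers p F) X (GalTwist.resField p F) ≃+
          TensorProduct (GalTwist.integers p F') X' (GalTwist.resField p F'))
        (hφ : ∀ g m, φ.toAddMonoidHom (GalTwist.tensorTriv ρ (GalTwist.resField p F) g m) =
          GalTwist.tensorTriv ρ' (GalTwist.resField p F') g (φ.toAddMonoidHom m)),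
        (LinearMap.range (GalTwist.deltaDual hρ hψ hres)).toAddSubgroup.map
            (GalTwist.H1map _ _ φ.toAddMonoidHom hφ) =
          (LinearMap.range (GalTwist.deltaDual hρ' hψ' hres')).toAddSubgroup := by
  obtain ⟨hres, hrange, hindep⟩ :=
    mainTheorem10_general p hFrob hρ hψ ⟨hunr, E, ϖ, hϖ, hreal, hv₀, hv₁⟩
  refine ⟨hres, hrange, ?_⟩
  intro F' _ _ _ X' _ _ _ _ ρ' hρ' ψ' hψ' hunr' E' hreal' _ ϖ' hϖ' hv₀' hv₁' _
  exact hindep F' X' ρ' hρ' ψ' hψ' ⟨hunr', E', ϖ', hϖ', hreal', hv₀', hv₁'⟩
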